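/- **Conventions.** ZFA is Zermelo–Fraenkel set theory without choice, with extensionality weakened so as to allow a set of atoms. Given a set $A$ of atoms, let $M=V(A)$ be the universe of all sets over $A$ (a model of ZFA with choice); every permutation $\pi$ of $A$ acts on $M$ by $\pi(x)=\{\pi(y):y\in x\}$ for sets $x$. For a group $\mathcal G$ of permutations of $A$ put $\mathrm{fix}_{\mathcal G}(E)=\{\pi\in\mathcal G:\pi(a)=a\ \forall a\in E\}$ for $E\subseteq A$ and $\mathrm{sym}_{\mathcal G}(x)=\{\pi\in\mathcal G:\pi(x)=x\}$ for $x\in M$. Let $\mathcal F$ be the filter of subgroups of $\mathcal G$ generated by the groups $\mathrm{fix}_{\mathcal G}(E)$ with $E\subseteq A$ finite. The permutation model determined by $\mathcal G$ (with finite supports) is the model $\{x\in M:\mathrm{sym}_{\mathcal G}(t)\in\mathcal F\text{ for all }t\in \mathrm{TC}(\{x\})\}$ of ZFA. Three such models are used: * $\mathcal N_1$ (basic Fraenkel model): $A$ is countably infinite and $\mathcal G$ is the group of all permutations of $A$. * $\mathcal N_3$ (Mostowski's linearly ordered model): $A$ carries a linear order isomorphic to that of $\mathbb Q$, and $\mathcal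 G$ is the group of all order automorphisms of $A$. * $\mathcal N_{26}$ (Brunner/Pincus model): $A=\bigcup_{k\in\omega}P_k$ with the $P_k$ pairwise disjoint and countably infinite, and $\mathcal G$ is the group of all permutations $\pi$ of $A$ with $\pi(P_k)=P_k$ for all $k$. The principles are the following. * $\mathsf{RRT}^m_n$: if $X$ and $C$ are infinite sets and $\chi:[X]^m\to C$ satisfies $|\chi^{-1}(c)|\le n$ for all $c\in C$, then there is an infinite $Y\subseteq X$ such that $\chi$ is injective on $[Y]^m$. (Here $[X]^m$ is the set of $m$-element subsets of $X$.) * An infinite set is *amorphous* if it is not the union of two disjoint infinite subsets. * $\mathsf{WOAM}$: every set is well-orderable or has an amorphous subset. * $\mathsf{CS}$: every poset without a maximal element has two disjoint cofinal subsets. * Antichain Principle: every poset has a maximal antichain (an antichain being a set of pairwise incomparable elements). * $\Delta SL$: every uncountable family of finite sets has an uncountable subfamily $\mathcal B$ for which there is a set $r$ with $x\cap y=r$ for all distinct $x,y\in\mathcal B$; a set is uncountable if it admits no injection into $\omega$. **Theorem.** Let $m,n\ge 2$ be integers. 1. $\mathsf{RRT}^m_n$ holds in $\mathcal N_1$, which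 is a model of ZFA with an amorphous set. Thus $\mathsf{RRT}^m_n$ does not imply "there are no amorphous sets" in ZFA. 2. $\mathsf{RRT}^m_n$ holds in $\mathcal N_3$, which is a model of ZFA in which $\mathsf{WOAM}$, $\mathsf{CS}$ and the Antichain Principle all fail. Consequently $\mathsf{RRT}^m_n$ implies none of $\mathsf{WOAM}$, $\mathsf{CS}$ and the Antichain Principle in ZFA. 3. $\mathcal N_{26}$ is a model of ZFA in which both $\mathsf{RRT}^m_n$ and $\Delta SL$ hold. -/

import Mathlib

universe u w

namespace FM

/-! ### The first-order language of set theory with atoms, and the theory ZFA -/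

/-- The relation symbols: a unary symbol "is an atom" and the binary symbol of membership. -/
inductive ZFARel : ℕ → Type
  | atom : ZFARel 1
  | mem : ZFARel 2

/-- The first-order language of set theory with atoms. -/
def zfaLang : FirstOrder.Language := ⟨fun _ => Empty, ZFARel⟩

/-- A structure for the language of set theory with atoms. -/
class ZFAStructure (V : Type u) where
  Mem : V → V → Prop
  IsAtom : V → Prop

infix:50 " ϵ " => ZFAStructure.Mem

instance instStructure (V : Type u) [ZFAStructure V] : zfaLang.Structure V where
  funMap := fun f => nomatch f
  RelMap := fun r => match r with
    | ZFARel.atom => fun v => ZFAStructure.IsAtom (v 0)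
    | ZFARel.mem => fun v => v 0 ϵ v 1

section Vocabulary

variable {V : Type u} [ZFAStructure V]

/-- `x` is a set, that is, not an atom. -/
def IsSet (x : V) : Prop := ¬ ZFAStructure.IsAtom x

/-- The class of the elements of `x`. -/
def elts (x : V) : Set V := {y | y ϵ x}

/-- `x` is a set that has the same elements as the class `K`. -/
def IsSetOf (x : V) (K : Set V) : Prop := IsSet x ∧ ∀ y, y ϵ x ↔ y ∈ K

/-- `y` is a set all of whose elements are elements of `x`. -/
def IsSubset (y x : V) : Prop := IsSet y ∧ ∀ z, z ϵ y → z ϵ x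

/-- `s = x ∪ {x}`. -/
def IsSucc (s x : V) : Prop := IsSetOf s {z | z ϵ x ∨ z = x}

/-- `w` is a set that contains the empty set and is closed under `x ↦ x ∪ {x}`. -/
def IsInductiveSet (w : V) : Prop :=
  IsSet w ∧ (∃ e, IsSetOf e ∅ ∧ e ϵ w) ∧ ∀ x, x ϵ w → ∃ s, IsSucc s x ∧ s ϵ w

/-- `p` is the Kuratowski pair `(a, b) = {{a}, {a, b}}`. -/
def IsOPair (p a b : V) : Prop :=
  ∃ s t, IsSetOf s {a} ∧ IsSetOf t {a, b} ∧ IsSetOf p {s, t}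

/-- The pair `(a, b)` is an element of `r`. -/
def Rel (r a b : V) : Prop := ∃ p, IsOPair p a b ∧ p ϵ r

/-- The set `f` is (the graph of) a function from the class `D` to the class `C`. -/
def IsMap (f : V) (D C : Set V) : Prop :=
  IsSet f ∧ (∀ p, p ϵ f → ∃ a ∈ D, ∃ b ∈ C, IsOPair p a b) ∧ ∀ a ∈ D, ∃! b, Rel f a b

/-- The set `f` is an injection from the class `D` to the class `C`. -/
def IsInj (f : V) (D C : Set V) : Prop :=
  IsMap f D C ∧ ∀ a a' b, Rel f a b → Rel f a' b → a = a'

/-- The set `f` is a bijection from the class `D` onto the class `C`. -/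
def IsBij (f : V) (D C : Set V) : Prop :=
  IsInj f D C ∧ ∀ b ∈ C, ∃ a, Rel f a b

variable (V) in
/-- The class `ω` of the structure: the elements that belong to every inductive set. -/
def omega : Set V := {n | ∀ w, IsInductiveSet w → n ϵ w}

/-- In the structure, `x` is a set equinumerous with an element of `ω`. -/
def IsFin (x : V) : Prop := IsSet x ∧ ∃ k ∈ omega V, ∃ f, IsBij f (elts x) (elts k)

/-- In the structure, `x` is an infinite set. -/
def IsInf (x : V) : Prop := IsSet x ∧ ¬ IsFin x

/-- In the structure, `x` is a set with `|x| ≤ ℵ₀`. -/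
def IsCountable (x : V) : Prop := IsSet x ∧ ∃ f, IsInj f (elts x) (omega V)

/-- In the structure, `x` is a set with `|x| ≰ ℵ₀`. -/
def IsUncountable (x : V) : Prop := IsSet x ∧ ¬ IsCountable x

/-- `[X]^m`: the subsets of `X` with exactly `m` elements (`m` a standard natural number). -/
def subsetsOfCard (m : ℕ) (X : V) : Set V := {s | IsSubset s X ∧ (elts s).encard = m}

/-- In the structure, `x` is an infinite set that is not the union of two disjoint infinite
subsets. -/
def IsAmorphous (x : V) : Prop :=
  IsInf x ∧ ¬ ∃ y z, IsSubset y x ∧ IsSubset z x ∧ IsInf y ∧ IsInf z ∧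
    (∀ t, ¬ (t ϵ y ∧ t ϵ z)) ∧ ∀ t, t ϵ x → t ϵ y ∨ t ϵ z

/-- In the structure, the set `r` is a strict linear order on `x` in which every non-empty subset
of `x` has a least element. -/
def IsWellOrderOn (r x : V) : Prop :=
  IsSet r ∧ (∀ a, a ϵ x → ¬ Rel r a a) ∧
  (∀ a b c, a ϵ x → b ϵ x → c ϵ x → Rel r a b → Rel r b c → Rel r a c) ∧
  (∀ a b, a ϵ x → b ϵ x → a = b ∨ Rel r a b ∨ Rel r b a) ∧
  ∀ y, IsSubset y x → (∃ a, a ϵ y) → ∃ a, a ϵ y ∧ ∀ b, b ϵ y → b = a ∨ Rel r a b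

/-- The set `r` is a (reflexive) partial order on the set `P`. -/
def IsPosetOn (r P : V) : Prop :=
  IsSet P ∧ IsSet r ∧ (∀ a, a ϵ P → Rel r a a) ∧
  (∀ a b, a ϵ P → b ϵ P → Rel r a b → Rel r b a → a = b) ∧
  ∀ a b c, a ϵ P → b ϵ P → c ϵ P → Rel r a b → Rel r b c → Rel r a c

/-- `Y` is a subset of `P` no two distinct elements of which are comparable. -/
def IsAntichainIn (r P Y : V) : Prop :=
  IsSubset Y P ∧ ∀ a b, a ϵ Y → b ϵ Y → Rel r a b → a = b

/-- `D` is a cofinal subset of `P`. -/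
def IsCofinalIn (r P D : V) : Prop :=
  IsSubset D P ∧ ∀ a, a ϵ P → ∃ c, c ϵ D ∧ Rel r a c

/-- `B` is a `Δ`-system: there is a set that is the intersection of any two distinct members. -/
def IsDeltaSystem (B : V) : Prop :=
  ∃ r, IsSet r ∧ ∀ x y, x ϵ B → y ϵ B → x ≠ y → ∀ z, (z ϵ x ∧ z ϵ y) ↔ z ϵ r

end Vocabulary

/-- `V` is a model of ZFA: extensionality for sets, atoms are without elements and form a set, and
the remaining axioms of Zermelo–Fraenkel set theory, with separation and replacement for all
first-order formulas with parameters. -/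
structure IsZFA (V : Type u) [ZFAStructure V] : Prop where
  atom_empty : ∀ a x : V, ZFAStructure.IsAtom a → ¬ x ϵ a
  atoms : ∃ a : V, IsSetOf a {x | ZFAStructure.IsAtom x}
  ext : ∀ x y : V, IsSet x → IsSet y → (∀ z, z ϵ x ↔ z ϵ y) → x = y
  empty : ∃ e : V, IsSetOf e ∅
  pairing : ∀ a b : V, ∃ p, IsSetOf p {a, b}
  union : ∀ x : V, ∃ s, IsSetOf s {z | ∃ y, y ϵ x ∧ z ϵ y}
  powerset : ∀ x : V, IsSet x → ∃ p, IsSetOf p {y | IsSubset y x}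
  infinity : ∃ ω : V, IsInductiveSet ω
  foundation : ∀ x : V, (∃ y, y ϵ x) → ∃ y, y ϵ x ∧ ∀ z, z ϵ y → ¬ z ϵ x
  separation : ∀ (k : ℕ) (φ : zfaLang.Formula (Fin k ⊕ Fin 1)) (p : Fin k → V) (x : V),
    ∃ s, IsSetOf s {y | y ϵ x ∧ φ.Realize (Sum.elim p ![y])}
  replacement : ∀ (k : ℕ) (φ : zfaLang.Formula (Fin k ⊕ Fin 2)) (p : Fin k → V) (x : V),
    (∀ y z z', y ϵ x → φ.Realize (Sum.elim p ![y, z]) → φ.Realize (Sum.elim p ![y, z']) →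
      z = z') →
    ∃ s, IsSetOf s {z | ∃ y, y ϵ x ∧ φ.Realize (Sum.elim p ![y, z])}

/-! ### The principles, as statements about a structure `V`

All quantifiers range over the elements of `V`. -/

/-- The rainbow Ramsey theorem `RRT^m_n`: every `n`-bounded coloring `χ : [X]^m → C` with `X` and
`C` infinite has an infinite polychromatic `Y ⊆ X`. -/
def RRT (m n : ℕ) (V : Type u) [ZFAStructure V] : Prop :=
  ∀ X C χ : V, IsInf X → IsInf C → IsMap χ (subsetsOfCard m X) (elts C) →
    (∀ c, c ϵ C → {s : V | Rel χ s c}.encard ≤ n) →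
    ∃ Y : V, IsSubset Y X ∧ IsInf Y ∧
      ∀ s ∈ subsetsOfCard m Y, ∀ t ∈ subsetsOfCard m Y, ∀ c, Rel χ s c → Rel χ t c → s = t

/-- There are no amorphous sets. -/
def NoAmorphous (V : Type u) [ZFAStructure V] : Prop := ¬ ∃ x : V, IsAmorphous x

/-- `WOAM`: every set is well-orderable or has an amorphous subset. -/
def WOAM (V : Type u) [ZFAStructure V] : Prop :=
  ∀ x : V, IsSet x → (∃ r, IsWellOrderOn r x) ∨ ∃ y, IsSubset y x ∧ IsAmorphous y

/-- `CS`: every poset without a maximal element has two disjoint cofinal subsets. -/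
def CS (V : Type u) [ZFAStructure V] : Prop :=
  ∀ P r : V, IsPosetOn r P → (¬ ∃ a, a ϵ P ∧ ∀ b, b ϵ P → Rel r a b → b = a) →
    ∃ D E, IsCofinalIn r P D ∧ IsCofinalIn r P E ∧ ∀ z, ¬ (z ϵ D ∧ z ϵ E)

/-- The Antichain Principle: every poset has a maximal antichain. -/
def AntichainPrinciple (V : Type u) [ZFAStructure V] : Prop :=
  ∀ P r : V, IsPosetOn r P →
    ∃ Y, IsAntichainIn r P Y ∧ ∀ Z, IsAntichainIn r P Z → IsSubset Y Z → Z = Y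

/-- `ΔSL`: every uncountable family of finite sets has an uncountable subfamily that is a
`Δ`-system. -/
def DeltaSL (V : Type u) [ZFAStructure V] : Prop :=
  ∀ F : V, IsUncountable F → (∀ x, x ϵ F → IsFin x) →
    ∃ B, IsSubset B F ∧ IsUncountable B ∧ IsDeltaSystem B

/-- `P` implies `Q` in ZFA: every model of ZFA that satisfies `P` satisfies `Q`. -/
def ImpliesInZFA (P Q : ∀ (V : Type w) [ZFAStructure V], Prop) : Prop :=
  ∀ (V : Type w) [ZFAStructure V], IsZFA V → P V → Q V

/-! ### The universe of sets over a set of atoms -/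

/-- Codes for the sets over the atoms `A`: an atom, or a set given by an indexed family of its
elements. -/
inductive Pre (A : Type u) : Type (u + 1)
  | atom : A → Pre A
  | mk : (ι : Type u) → (ι → Pre A) → Pre A

namespace Pre

variable {A : Type u}

/-- Extensional equality of codes. -/
def Eqv : Pre A → Pre A → Prop
  | atom a, atom b => a = b
  | mk _ f, mk _ g => (∀ i, ∃ j, Eqv (f i) (g j)) ∧ ∀ j, ∃ i, Eqv (f i) (g j)
  | atom _, mk _ _ => False
  | mk _ _, atom _ => False

theorem Eqv.refl : ∀ x : Pre A, Eqv x x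
  | atom _ => rfl
  | mk _ f => ⟨fun i => ⟨i, Eqv.refl (f i)⟩, fun i => ⟨i, Eqv.refl (f i)⟩⟩

theorem Eqv.symm : ∀ {x y : Pre A}, Eqv x y → Eqv y x
  | atom _, atom _, h => Eq.symm h
  | mk _ _, mk _ _, h =>
    ⟨fun j => (h.2 j).imp fun _ hi => Eqv.symm hi, fun i => (h.1 i).imp fun _ hj => Eqv.symm hj⟩
  | atom _, mk _ _, h => h
  | mk _ _, atom _, h => h

theorem Eqv.trans : ∀ {x y z : Pre A}, Eqv x y → Eqv y z → Eqv x z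
  | atom _, atom _, atom _, h, k => Eq.trans h k
  | mk _ _, mk _ _, mk _ _, h, k =>
    ⟨fun i => let ⟨j, hj⟩ := h.1 i; let ⟨l, hl⟩ := k.1 j; ⟨l, Eqv.trans hj hl⟩,
      fun l => let ⟨j, hj⟩ := k.2 l; let ⟨i, hi⟩ := h.2 j; ⟨i, Eqv.trans hi hj⟩⟩
  | atom _, mk _ _, _, h, _ => h.elim
  | mk _ _, atom _, _, h, _ => h.elim
  | atom _, atom _, mk _ _, _, k => k.elim
  | mk _ _, mk _ _, atom _, _, k => k.elim

instance setoid (A : Type u) : Setoid (Pre A) := ⟨Eqv, Eqv.refl, Eqv.symm, Eqv.trans⟩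

/-- The code `x` is extensionally equal to one of the listed elements of `y`. -/
def Mem (x : Pre A) : Pre A → Prop
  | atom _ => False
  | mk _ g => ∃ j, Eqv x (g j)

theorem mem_congr {x x' y y' : Pre A} (hx : Eqv x x') (hy : Eqv y y') : Mem x y → Mem x' y' :=
  match y, y', hy with
  | atom _, atom _, _ => id
  | mk _ _, mk _ _, hy => fun ⟨j, hj⟩ =>
    let ⟨l, hl⟩ := hy.1 j; ⟨l, hx.symm.trans (hj.trans hl)⟩

/-- The code `x` is an atom. -/
def IsAtom : Pre A → Prop
  | atom _ => True
  | mk _ _ => False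

theorem isAtom_congr {x y : Pre A} (h : Eqv x y) : IsAtom x ↔ IsAtom y :=
  match x, y, h with
  | atom _, atom _, _ => Iff.rfl
  | mk _ _, mk _ _, _ => Iff.rfl

/-- A permutation of the atoms acts on codes by renaming the atoms. -/
def act (π : Equiv.Perm A) : Pre A → Pre A
  | atom a => atom (π a)
  | mk ι f => mk ι fun i => act π (f i)

theorem act_congr (π : Equiv.Perm A) : ∀ {x y : Pre A}, Eqv x y → Eqv (act π x) (act π y)
  | atom _, atom _, h => congrArg π h
  | mk _ _, mk _ _, h =>
    ⟨fun i => (h.1 i).imp fun _ hj => act_congr π hj, fun j => (h.2 j).imp fun _ hi => act_congr π hi⟩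
  | atom _, mk _ _, h => h
  | mk _ _, atom _, h => h

theorem act_one : ∀ x : Pre A, act 1 x = x
  | atom _ => rfl
  | mk ι f => congrArg (mk ι) (funext fun i => act_one (f i))

theorem act_mul (π ρ : Equiv.Perm A) : ∀ x : Pre A, act (π * ρ) x = act π (act ρ x)
  | atom _ => rfl
  | mk ι f => congrArg (mk ι) (funext fun i => act_mul π ρ (f i))

end Pre

/-- The universe of all sets over the set `A` of atoms (the cumulative hierarchy built from `A`). -/
def Univ (A : Type u) : Type (u + 1) := Quotient (Pre.setoid A)

instance instUniv (A : Type u) : ZFAStructure (Univ A) where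
  Mem := Quotient.lift₂ Pre.Mem fun _ _ _ _ hx hy =>
    propext ⟨Pre.mem_congr hx hy, Pre.mem_congr (Pre.Eqv.symm hx) (Pre.Eqv.symm hy)⟩
  IsAtom := Quotient.lift Pre.IsAtom fun _ _ h => propext (Pre.isAtom_congr h)

/-- The action of the permutations of the atoms on the universe:
`π • a` is `π a` for an atom `a`, and `π • x = {π • y : y ∈ x}` for a set `x`. -/
instance instMulAction (A : Type u) : MulAction (Equiv.Perm A) (Univ A) where
  smul π := Quotient.map (Pre.act π) fun _ _ h => Pre.act_congr π h
  one_smul := by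
    rintro ⟨x⟩
    exact congrArg (Quotient.mk _) (Pre.act_one x)
  mul_smul := by
    rintro π ρ ⟨x⟩
    exact congrArg (Quotient.mk _) (Pre.act_mul π ρ x)

/-! ### Permutation models -/

section Models

variable {A : Type u}

/-- `sym_G(x)`: the elements of the group `G` of permutations that map `x` to itself. -/
def symGroup (G : Subgroup (Equiv.Perm A)) (x : Univ A) : Subgroup (Equiv.Perm A) :=
  G ⊓ MulAction.stabilizer (Equiv.Perm A) x

/-- `fix_G(E)`: the elements of `G` that fix every atom in `E`. -/
def fixGroup (G : Subgroup (Equiv.Perm A)) (E : Set A) : Subgroup (Equiv.Perm A) :=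
  G ⊓ fixingSubgroup (Equiv.Perm A) E

/-- The filter of subgroups of `G` generated by the groups `fix_G(E)`, `E` a finite set of atoms.
(As `fix_G(E) ∩ fix_G(E') = fix_G(E ∪ E')`, these groups are a filter base.) -/
def finiteSupportFilter (G : Subgroup (Equiv.Perm A)) : Set (Subgroup (Equiv.Perm A)) :=
  {H | H ≤ G ∧ ∃ E : Set A, E.Finite ∧ fixGroup G E ≤ H}

/-- The permutation model determined by the universe over `A`, the group `G` and the filter `F`:
the `x` such that `sym_G(t) ∈ F` for every `t` in the transitive closure of `{x}`. -/
def PermModel (G : Subgroup (Equiv.Perm A)) (F : Set (Subgroup (Equiv.Perm A))) : Type (u + 1) :=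
  {x : Univ A // ∀ t : Univ A, Relation.ReflTransGen ZFAStructure.Mem t x → symGroup G t ∈ F}

instance instPermModel (G : Subgroup (Equiv.Perm A)) (F : Set (Subgroup (Equiv.Perm A))) :
    ZFAStructure (PermModel G F) where
  Mem x y := x.1 ϵ y.1
  IsAtom x := ZFAStructure.IsAtom x.1

/-- The group of the order automorphisms of a linear order, as permutations. -/
def orderAutGroup (A : Type u) [LinearOrder A] : Subgroup (Equiv.Perm A) where
  carrier := {π | ∀ a b, π a < π b ↔ a < b}
  one_mem' := fun _ _ => Iff.rfl
  mul_mem' := fun {π ρ} hπ hρ a b => (hπ (ρ a) (ρ b)).trans (hρ a b)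
  inv_mem' := fun {π} hπ a b => by
    simpa using (hπ (π⁻¹ a) (π⁻¹ b)).symm

/-- The group of the permutations that map every block `P k` onto itself. -/
def blockGroup (P : ℕ → Set A) : Subgroup (Equiv.Perm A) where
  carrier := {π | ∀ k, π '' P k = P k}
  one_mem' := fun k => by simp
  mul_mem' := fun {π ρ} hπ hρ k => by
    rw [Equiv.Perm.coe_mul, Set.image_comp, hρ k, hπ k]
  inv_mem' := fun {π} hπ k => by
    conv_lhs => rw [← hπ k]
    rw [← Set.image_comp, ← Equiv.Perm.coe_mul, inv_mul_cancel]
    simp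

end Models

/-- The basic Fraenkel model over the atoms `A` (for `A` countably infinite). -/
abbrev N1 (A : Type u) : Type (u + 1) :=
  PermModel (⊤ : Subgroup (Equiv.Perm A)) (finiteSupportFilter ⊤)

/-- Mostowski's linearly ordered model over the atoms `A` (for `A` isomorphic to `ℚ`). -/
abbrev N3 (A : Type u) [LinearOrder A] : Type (u + 1) :=
  PermModel (orderAutGroup A) (finiteSupportFilter (orderAutGroup A))

/-- The Brunner/Pincus model over the atoms `A` partitioned into the blocks `P k` (for a countable
`A` and infinite blocks). -/
abbrev N26 {A : Type u} (P : ℕ → Set A) : Type (u + 1) :=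
  PermModel (blockGroup P) (finiteSupportFilter (blockGroup P))

end FM

namespace FM

/-! ### Infinite combinatorics -/

open Filter in
/-- The infinite Ramsey theorem. -/
theorem exists_infinite_monochromatic {α κ : Type*} [Infinite α] [Finite κ] (m : ℕ)
    (f : Finset α → κ) :
    ∃ (Y : Set α) (c : κ), Y.Infinite ∧ ∀ s : Finset α, (s : Set α) ⊆ Y → s.card = m → f s = c := by
  classical
  have lim : ∀ h : α → κ, ∃ c, ∀ᶠ x in (hyperfilter α : Filter α), h x = c := by
    intro h
    obtain ⟨c, hc⟩ := ((hyperfilter α).map h).eq_pure_of_finite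
    have : {c} ∈ (hyperfilter α).map h := by
      rw [hc]
      exact Set.mem_singleton c
    exact ⟨c, this⟩
  choose L hL using lim
  let g : ℕ → Finset α → κ := fun k => Nat.rec f (fun _ g s => L fun x => g (insert x s)) k
  let c := g m ∅
  let Nice : Finset α → Prop := fun F => ∀ s ⊆ F, s.card ≤ m → g (m - s.card) s = c
  have nice0 : Nice ∅ := by
    intro s hs _
    obtain rfl := Finset.subset_empty.1 hs
    simp [c]
  have step : ∀ F, Nice F → ∃ x, x ∉ F ∧ Nice (insert x F) := by
    intro F hF
    have h1 : ∀ᶠ x in (hyperfilter α : Filter α), x ∉ F := by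
      have : (F : Set α)ᶜ ∈ hyperfilter α := F.finite_toSet.compl_mem_hyperfilter
      exact this
    have h2 : ∀ᶠ x in (hyperfilter α : Filter α), ∀ s ∈ F.powerset, s.card < m →
        g (m - (s.card + 1)) (insert x s) = c := by
      rw [Filter.eventually_all_finset]
      intro s hs
      by_cases hm : s.card < m
      · have := hF s (Finset.mem_powerset.1 hs) hm.le
        obtain ⟨k, hk⟩ : ∃ k, m - s.card = k + 1 := ⟨m - s.card - 1, by omega⟩
        have hk' : m - (s.card + 1) = k := by omega
        rw [hk] at this
        rw [hk']
        filter_upwards [hL fun x => g k (insert x s)] with x hx _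
        exact hx.trans this
      · exact Filter.Eventually.of_forall fun _ h => absurd h hm
    obtain ⟨x, hx1, hx2⟩ := (h1.and h2).exists
    refine ⟨x, hx1, fun s hs hsm => ?_⟩
    by_cases hxs : x ∈ s
    · have hcard := Finset.card_erase_of_mem hxs
      have hpos : 0 < s.card := Finset.card_pos.2 ⟨x, hxs⟩
      have hsub : s.erase x ⊆ F := by
        intro y hy
        have := hs (Finset.mem_of_mem_erase hy)
        exact (Finset.mem_insert.1 this).resolve_left (Finset.ne_of_mem_erase hy)
      have := hx2 (s.erase x) (Finset.mem_powerset.2 hsub) (by omega)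
      rw [Finset.insert_erase hxs, hcard, Nat.sub_add_cancel hpos] at this
      exact this
    · exact hF s (fun y hy => (Finset.mem_insert.1 (hs hy)).resolve_left
        (fun h => hxs (h ▸ hy))) hsm
  choose! nx hnx using step
  let F : ℕ → Finset α := fun k => Nat.rec ∅ (fun _ F => insert (nx F) F) k
  have hF : ∀ k, Nice (F k) := by
    intro k
    induction k with
    | zero => exact nice0
    | succ k ih => exact (hnx _ ih).2
  have hcard : ∀ k, (F k).card = k := by
    intro k
    induction k with
    | zero => rfl
    | succ k ih => exact (Finset.card_insert_of_notMem (hnx _ (hF k)).1).trans (by rw [ih])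
  have hmono : Monotone F := monotone_nat_of_le_succ fun k => Finset.subset_insert _ _
  clear_value F
  refine ⟨{y | ∃ k, y ∈ F k}, c, fun hfin => ?_, fun s hs hsm => ?_⟩
  · have : (F (hfin.toFinset.card + 1)).card ≤ hfin.toFinset.card := by
      apply Finset.card_le_card
      intro y hy
      exact hfin.mem_toFinset.2 ⟨_, hy⟩
    rw [hcard] at this
    omega
  · choose! i hi using fun y (hy : y ∈ s) => hs hy
    have hk : s ⊆ F (s.sup i) := fun y hy => hmono (Finset.le_sup (f := i) hy) (hi y hy)
    have := hF _ s hk hsm.le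
    rwa [hsm, Nat.sub_self] at this

/-- The rainbow Ramsey theorem for bounded colorings, by Galvin's trick. -/
theorem exists_infinite_polychromatic {α C : Type*} [Infinite α] (m n : ℕ) (χ : Finset α → C)
    (hχ : ∀ c, {s : Finset α | s.card = m ∧ χ s = c}.encard ≤ n) :
    ∃ Y : Set α, Y.Infinite ∧ ∀ s t : Finset α, (s : Set α) ⊆ Y → (t : Set α) ⊆ Y →
      s.card = m → t.card = m → χ s = χ t → s = t := by
  have : ∀ c, ∃ f : Finset α → Fin (n + 1),
      Set.InjOn f {s : Finset α | s.card = m ∧ χ s = c} := by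
    intro c
    have hfin : {s : Finset α | s.card = m ∧ χ s = c}.Finite :=
      Set.finite_of_encard_le_coe (hχ c)
    obtain ⟨f, -, hf⟩ := hfin.exists_injOn_of_encard_le (t := (Set.univ : Set (Fin (n + 1)))) (by
      refine (hχ c).trans ?_
      rw [Set.encard_univ, ENat.card_eq_coe_fintype_card, Fintype.card_fin]
      exact_mod_cast Nat.le_succ n)
    exact ⟨f, hf⟩
  choose f hf using this
  obtain ⟨Y, k, hY, hk⟩ := exists_infinite_monochromatic m fun s => f (χ s) s
  refine ⟨Y, hY, fun s t hs ht hsm htm h => ?_⟩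
  refine hf (χ s) ⟨hsm, rfl⟩ ⟨htm, h.symm⟩ ?_
  have h1 := hk s hs hsm
  have h2 := hk t ht htm
  rw [← h] at h2
  exact h1.trans h2.symm

theorem exists_delta_of_card {β : Type*} [DecidableEq β] (k : ℕ) : ∀ F : Set (Finset β),
    ¬ F.Countable → (∀ s ∈ F, s.card = k) →
    ∃ B ⊆ F, ¬ B.Countable ∧ ∃ r, ∀ s ∈ B, ∀ t ∈ B, s ≠ t → s ∩ t = r := by
  induction k with
  | zero =>
    intro F hF h
    refine absurd ((Set.countable_singleton (∅ : Finset β)).mono fun s hs => ?_) hF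
    exact Finset.card_eq_zero.1 (h s hs)
  | succ k ih =>
    intro F hF h
    by_cases hz : ∃ z, ¬ {s ∈ F | z ∈ s}.Countable
    · obtain ⟨z, hz⟩ := hz
      have hinj : Set.InjOn (fun s : Finset β => s.erase z) {s ∈ F | z ∈ s} := by
        intro s hs t ht hst
        rw [← Finset.insert_erase hs.2, ← Finset.insert_erase ht.2]
        exact congrArg (insert z) hst
      obtain ⟨B, hB, hBc, r, hr⟩ := ih ((fun s : Finset β => s.erase z) '' {s ∈ F | z ∈ s})
        (fun hc => hz (Set.countable_of_injective_of_countable_image hinj hc)) (by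
          rintro _ ⟨s, hs, rfl⟩
          simp only
          rw [Finset.card_erase_of_mem hs.2, h s hs.1]
          rfl)
      have hzB : ∀ s ∈ B, z ∉ s := by
        intro s hs
        obtain ⟨t, -, rfl⟩ := hB hs
        exact Finset.notMem_erase z t
      refine ⟨(insert z) '' B, ?_, fun hc => hBc ?_, insert z r, ?_⟩
      · rintro _ ⟨s, hs, rfl⟩
        obtain ⟨t, ht, rfl⟩ := hB hs
        simp only
        rw [Finset.insert_erase ht.2]
        exact ht.1
      · refine Set.countable_of_injective_of_countable_image (f := insert z) ?_ hc
        intro s hs t ht hst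
        rw [← Finset.erase_insert (hzB s hs), ← Finset.erase_insert (hzB t ht), hst]
      · rintro _ ⟨s, hs, rfl⟩ _ ⟨t, ht, rfl⟩ hst
        rw [← Finset.insert_inter_distrib, hr s hs t ht fun h => hst (by rw [h])]
    · push Not at hz
      obtain ⟨B, hB⟩ := zorn_subset {B : Set (Finset β) | B ⊆ F ∧ B.PairwiseDisjoint id} (by
        intro c hc hchain
        refine ⟨⋃₀ c, ⟨Set.sUnion_subset fun s hs => (hc hs).1, ?_⟩,
          fun s hs => Set.subset_sUnion_of_mem hs⟩
        exact (Set.pairwiseDisjoint_sUnion hchain.directedOn).2 fun s hs => (hc hs).2)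
      refine ⟨B, hB.prop.1, fun hBc => hF ?_, ∅, fun s hs t ht hst =>
        Finset.disjoint_iff_inter_eq_empty.1 (hB.prop.2 hs ht hst)⟩
      have hc : (⋃ s ∈ B, ⋃ z ∈ (s : Set β), {t ∈ F | z ∈ t}).Countable :=
        hBc.biUnion fun s _ => s.countable_toSet.biUnion fun z _ => hz z
      refine hc.mono fun t ht => ?_
      by_contra hcon
      have hdis : ∀ s ∈ B, Disjoint s t := by
        intro s hs
        rw [Finset.disjoint_left]
        intro z hzs hzt
        exact hcon (Set.mem_biUnion hs (Set.mem_biUnion (Finset.mem_coe.2 hzs) ⟨ht, hzt⟩))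
      have htB : t ∈ B := by
        have := hB.le_of_ge (y := insert t B) ⟨Set.insert_subset ht hB.prop.1,
          hB.prop.2.insert fun s hs _ => (hdis s hs).symm⟩ (Set.subset_insert _ _)
        exact this (Set.mem_insert _ _)
      have hte := Finset.disjoint_self_iff_empty t |>.1 (hdis t htB)
      have := h t ht
      rw [hte, Finset.card_empty] at this
      omega

/-- The `Δ`-system lemma for uncountable families of finite sets. -/
theorem exists_delta {β : Type*} [DecidableEq β] (F : Set (Finset β)) (hF : ¬ F.Countable) :
    ∃ B ⊆ F, ¬ B.Countable ∧ ∃ r, ∀ s ∈ B, ∀ t ∈ B, s ≠ t → s ∩ t = r := by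
  have : ∃ k, ¬ {s ∈ F | s.card = k}.Countable := by
    by_contra! h
    refine hF ((Set.countable_iUnion h).mono fun s hs => ?_)
    exact Set.mem_iUnion.2 ⟨s.card, hs, rfl⟩
  obtain ⟨k, hk⟩ := this
  obtain ⟨B, hB, hBc, r⟩ := exists_delta_of_card k _ hk fun s hs => hs.2
  exact ⟨B, hB.trans (Set.sep_subset _ _), hBc, r⟩

open Order PartialIso in
/-- A finite partial isomorphism between countable dense linear orders without endpoints extends to
an isomorphism. -/
theorem exists_orderIso_extending {α β : Type*} [LinearOrder α] [LinearOrder β]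
    [Countable α] [DenselyOrdered α] [NoMinOrder α] [NoMaxOrder α] [Nonempty α]
    [Countable β] [DenselyOrdered β] [NoMinOrder β] [NoMaxOrder β] [Nonempty β]
    (p : PartialIso α β) : ∃ e : α ≃o β, ∀ x ∈ p.1, e x.1 = x.2 := by
  cases nonempty_encodable α
  cases nonempty_encodable β
  let to_cofinal : α ⊕ β → Cofinal (PartialIso α β) := fun p ↦
    Sum.recOn p (definedAtLeft β) (definedAtRight α)
  let our_ideal : Ideal (PartialIso α β) := idealOfCofinals p to_cofinal
  let F a := funOfIdeal a our_ideal (cofinal_meets_idealOfCofinals _ to_cofinal (Sum.inl a))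
  let G b := invOfIdeal b our_ideal (cofinal_meets_idealOfCofinals _ to_cofinal (Sum.inr b))
  refine ⟨OrderIso.ofCmpEqCmp (fun a ↦ (F a).val) (fun b ↦ (G b).val) fun a b ↦ by
      rcases (F a).prop with ⟨f, hf, ha⟩
      rcases (G b).prop with ⟨g, hg, hb⟩
      rcases our_ideal.directed _ hf _ hg with ⟨m, _, fm, gm⟩
      exact m.prop (a, _) (fm ha) (_, b) (gm hb), fun x hx => ?_⟩
  change (F x.1).val = x.2
  rcases (F x.1).prop with ⟨f, hf, ha⟩
  rcases our_ideal.directed _ hf _ (mem_idealOfCofinals p to_cofinal) with ⟨m, _, fm, gm⟩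
  have := m.prop (x.1, _) (fm ha) x (gm hx)
  simpa using this.symm

open ZFAStructure

/-! ### The universe over a set of atoms -/

namespace Univ

variable {A : Type u}

/-- The element of the universe with a given code. -/
def ofPre (x : Pre A) : Univ A := Quotient.mk _ x

theorem exists_ofPre (x : Univ A) : ∃ y, ofPre y = x := Quotient.exists_rep x

theorem ofPre_eq_ofPre {x y : Pre A} : ofPre x = ofPre y ↔ x.Eqv y := Quotient.eq (r := Pre.setoid A)

/-- A code of an element of the universe. -/
noncomputable def code (x : Univ A) : Pre A := (exists_ofPre x).choose

theorem ofPre_code (x : Univ A) : ofPre x.code = x := (exists_ofPre x).choose_spec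

theorem ofPre_mem_mk {x : Pre A} {ι : Type u} {f : ι → Pre A} :
    ofPre x ϵ ofPre (Pre.mk ι f) ↔ ∃ i, x.Eqv (f i) := Iff.rfl

/-- The atom `a` as an element of the universe. -/
def ofAtom (a : A) : Univ A := ofPre (Pre.atom a)

/-- The set with a given small class of elements. -/
noncomputable def ofSet (K : Set (Univ A)) [Small.{u} K] : Univ A :=
  ofPre (Pre.mk (Shrink.{u} K) fun i => ((equivShrink K).symm i).1.code)

theorem isAtom_ofAtom (a : A) : IsAtom (ofAtom a) := trivial

theorem not_isAtom_ofSet (K : Set (Univ A)) [Small.{u} K] : ¬ IsAtom (ofSet K) := fun h => h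

theorem mem_ofSet {K : Set (Univ A)} [Small.{u} K] {x : Univ A} : x ϵ ofSet K ↔ x ∈ K := by
  obtain ⟨x, rfl⟩ := exists_ofPre x
  constructor
  · intro h
    obtain ⟨j, hj⟩ := ofPre_mem_mk.1 h
    rw [ofPre_eq_ofPre.2 hj, ofPre_code]
    exact ((equivShrink K).symm j).2
  · intro hx
    refine ofPre_mem_mk.2 ⟨equivShrink K ⟨_, hx⟩, ofPre_eq_ofPre.1 ?_⟩
    rw [ofPre_code, Equiv.symm_apply_apply]

theorem exists_ofAtom {x : Univ A} (h : IsAtom x) : ∃ a, x = ofAtom a := by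
  obtain ⟨x | x, rfl⟩ := exists_ofPre x
  · exact ⟨x, rfl⟩
  · exact h.elim

theorem ofAtom_injective : Function.Injective (ofAtom : A → Univ A) := fun _ _ h =>
  ofPre_eq_ofPre.1 h

theorem not_mem_of_isAtom {x y : Univ A} (h : IsAtom y) : ¬ x ϵ y := by
  obtain ⟨y | y, rfl⟩ := exists_ofPre y
  · obtain ⟨x, rfl⟩ := exists_ofPre x
    exact id
  · exact h.elim

theorem ext {x y : Univ A} (hx : ¬ IsAtom x) (hy : ¬ IsAtom y) (h : ∀ z, z ϵ x ↔ z ϵ y) :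
    x = y := by
  obtain ⟨x | ⟨ι, f⟩, rfl⟩ := exists_ofPre x
  · exact absurd trivial hx
  obtain ⟨y | ⟨κ, g⟩, rfl⟩ := exists_ofPre y
  · exact absurd trivial hy
  refine ofPre_eq_ofPre.2 ⟨fun i => (h (ofPre (f i))).1 ⟨i, Pre.Eqv.refl _⟩, fun j => ?_⟩
  obtain ⟨i, hi⟩ := (h (ofPre (g j))).2 ⟨j, Pre.Eqv.refl _⟩
  exact ⟨i, hi.symm⟩

instance small_elts (x : Univ A) : Small.{u} (elts x) := by
  obtain ⟨x | ⟨ι, f⟩, rfl⟩ := exists_ofPre x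
  · have : elts (ofPre (Pre.atom x) : Univ A) = ∅ :=
      Set.eq_empty_of_forall_notMem fun y => not_mem_of_isAtom (isAtom_ofAtom x)
    rw [this]
    infer_instance
  · refine small_subset (t := elts (ofPre (Pre.mk ι f) : Univ A))
      (s := Set.range fun i => (ofPre (f i) : Univ A)) fun y hy => ?_
    obtain ⟨y, rfl⟩ := exists_ofPre y
    obtain ⟨i, hi⟩ := hy
    exact ⟨i, (ofPre_eq_ofPre.2 hi).symm⟩

theorem mem_induction {p : Univ A → Prop} (h : ∀ x, (∀ y, y ϵ x → p y) → p x) (x : Univ A) :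
    p x := by
  obtain ⟨x, rfl⟩ := exists_ofPre x
  induction x with
  | atom a => exact h _ fun y hy => absurd hy (not_mem_of_isAtom (isAtom_ofAtom a))
  | mk ι f ih =>
    refine h _ fun y hy => ?_
    obtain ⟨y, rfl⟩ := exists_ofPre y
    obtain ⟨i, hi⟩ := hy
    rw [ofPre_eq_ofPre.2 hi]
    exact ih i

theorem mem_wf : WellFounded (fun x y : Univ A => x ϵ y) :=
  ⟨mem_induction fun _ h => ⟨_, h⟩⟩

theorem smul_ofAtom (π : Equiv.Perm A) (a : A) : π • ofAtom a = ofAtom (π a) := rfl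

theorem isAtom_smul (π : Equiv.Perm A) {x : Univ A} : IsAtom (π • x) ↔ IsAtom x := by
  obtain ⟨x | x, rfl⟩ := exists_ofPre x <;> exact Iff.rfl

theorem smul_mem_smul_of_mem (π : Equiv.Perm A) {x y : Univ A} (h : x ϵ y) : π • x ϵ π • y := by
  obtain ⟨x, rfl⟩ := exists_ofPre x
  obtain ⟨y | ⟨ι, f⟩, rfl⟩ := exists_ofPre y
  · exact h.elim
  · obtain ⟨i, hi⟩ := h
    exact ⟨i, Pre.act_congr π hi⟩

theorem smul_mem_smul (π : Equiv.Perm A) {x y : Univ A} : π • x ϵ π • y ↔ x ϵ y := by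
  refine ⟨fun h => ?_, smul_mem_smul_of_mem π⟩
  simpa using smul_mem_smul_of_mem π⁻¹ h

end Univ

/-! ### The permutation models with finite supports -/

/-- The permutation model given by the group `G` with finite supports. -/
abbrev FinModel {A : Type u} (G : Subgroup (Equiv.Perm A)) : Type (u + 1) :=
  PermModel G (finiteSupportFilter G)

section

variable {A : Type u} {G : Subgroup (Equiv.Perm A)}

/-- `x` is fixed by all elements of `G` that fix every atom in `E`. -/
def Supp (G : Subgroup (Equiv.Perm A)) {X : Type*} [SMul G X] (E : Set A) (x : X) : Prop :=
  ∀ π : G, (∀ e ∈ E, π.1 e = e) → π • x = x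

theorem Supp.mono {X : Type*} [SMul G X] {E E' : Set A} {x : X} (h : Supp G E x) (hE : E ⊆ E') :
    Supp G E' x := fun π hπ => h π fun e he => hπ e (hE he)

theorem Supp.smul {X : Type*} [MulAction G X] {E : Set A} {x : X} (h : Supp G E x) (π : G) :
    Supp G (π.1 '' E) (π • x) := by
  intro ρ hρ
  have := h (π⁻¹ * ρ * π) fun e he => by
    have := hρ _ ⟨e, he, rfl⟩
    simp [this]
  rw [mul_smul, mul_smul, inv_smul_eq_iff] at this
  exact this

/-- The class `K` is invariant under the elements of `G` that fix every atom in `E`. -/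
def Inv (G : Subgroup (Equiv.Perm A)) {X : Type*} [SMul G X] (E : Set A) (K : Set X) : Prop :=
  ∀ π : G, (∀ e ∈ E, π.1 e = e) → ∀ x ∈ K, π • x ∈ K

theorem mem_finiteSupportFilter {x : Univ A} :
    symGroup G x ∈ finiteSupportFilter G ↔ ∃ E : Set A, E.Finite ∧ Supp G E x := by
  refine ⟨fun ⟨_, E, hE, h⟩ => ⟨E, hE, fun π hπ => ?_⟩,
    fun ⟨E, hE, h⟩ => ⟨inf_le_left, E, hE, fun π hπ => ⟨hπ.1, ?_⟩⟩⟩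
  · exact (h ⟨π.2, (mem_fixingSubgroup_iff _).2 fun e he => hπ e he⟩).2
  · exact h ⟨π, hπ.1⟩ fun e he => (mem_fixingSubgroup_iff _).1 hπ.2 e he

namespace FinModel

theorem mem_of_mem {x : FinModel G} {y : Univ A} (h : y ϵ x.1) :
    ∀ t : Univ A, Relation.ReflTransGen Mem t y → symGroup G t ∈ finiteSupportFilter G :=
  fun t ht => x.2 t (ht.tail h)

instance : MulAction G (FinModel G) where
  smul π x := ⟨π.1 • x.1, fun t ht => by
    have : Relation.ReflTransGen Mem (π⁻¹.1 • t) x.1 := by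
      generalize hy : π.1 • x.1 = y at ht
      have hy' : x.1 = π⁻¹.1 • y := by rw [← hy]; simp
      rw [hy']
      exact Relation.ReflTransGen.lift (p := Mem) (fun z => π⁻¹.1 • z)
        (fun _ _ h => Univ.smul_mem_smul_of_mem _ h) _ _ ht
    obtain ⟨E, hE, h⟩ := mem_finiteSupportFilter.1 (x.2 _ this)
    refine mem_finiteSupportFilter.2 ⟨π.1 '' E, hE.image _, ?_⟩
    have h' := Supp.smul (X := Univ A) h π
    have e : π • (π⁻¹.1 • t) = t := by
      change π.1 • (π⁻¹.1 • t) = t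
      simp
    rwa [e] at h'⟩
  one_smul x := Subtype.ext (one_smul _ x.1)
  mul_smul π ρ x := Subtype.ext (mul_smul π.1 ρ.1 x.1)

theorem smul_mem_smul (π : G) {x y : FinModel G} : π • x ϵ π • y ↔ x ϵ y :=
  Univ.smul_mem_smul π.1

theorem isAtom_smul (π : G) {x : FinModel G} : IsAtom (π • x) ↔ IsAtom x :=
  Univ.isAtom_smul π.1

theorem isSet_smul (π : G) {x : FinModel G} : IsSet (π • x) ↔ IsSet x :=
  not_congr (isAtom_smul π)

theorem not_mem_of_isAtom {x y : FinModel G} (h : IsAtom y) : ¬ x ϵ y :=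
  Univ.not_mem_of_isAtom (A := A) h

theorem ext {x y : FinModel G} (hx : IsSet x) (hy : IsSet y) (h : ∀ z, z ϵ x ↔ z ϵ y) : x = y :=
  Subtype.ext <| Univ.ext hx hy fun z =>
    ⟨fun hz => (h ⟨z, mem_of_mem hz⟩).1 hz, fun hz => (h ⟨z, mem_of_mem hz⟩).2 hz⟩

theorem exists_supp (x : FinModel G) : ∃ E : Set A, E.Finite ∧ Supp G E x := by
  obtain ⟨E, hE, h⟩ := mem_finiteSupportFilter.1 (x.2 x.1 .refl)
  exact ⟨E, hE, fun π hπ => Subtype.ext (h π hπ)⟩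

instance small_elts (x : FinModel G) : Small.{u} (elts x) :=
  small_of_injective (β := elts x.1) (f := fun y : elts x => ⟨y.1.1, y.2⟩) fun y z h => by
    have : y.1.1 = z.1.1 := congrArg (fun t : elts x.1 => t.1) h
    exact Subtype.ext (Subtype.ext this)

theorem mem_wf : WellFounded (fun x y : FinModel G => x ϵ y) :=
  InvImage.wf Subtype.val Univ.mem_wf

/-- A small invariant class of elements of the model is a set of the model. -/
theorem exists_isSetOf (K : Set (FinModel G)) [Small.{u} K] {E : Set A} (hE : E.Finite)
    (hK : Inv G E K) : ∃ s : FinModel G, IsSetOf s K := by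
  let K' : Set (Univ A) := (fun x : FinModel G => x.1) '' K
  have : Small.{u} K' := small_image _ _
  let s := Univ.ofSet K'
  have hs : Supp G E s := by
    have key : ∀ π : G, (∀ e ∈ E, π.1 e = e) → ∀ z, z ϵ s → π.1 • z ϵ s := by
      intro π hπ z hz
      obtain ⟨x, hx, rfl⟩ := Univ.mem_ofSet.1 hz
      exact Univ.mem_ofSet.2 ⟨π • x, hK π hπ x hx, rfl⟩
    intro π hπ
    refine Univ.ext (fun h => Univ.not_isAtom_ofSet _ ((Univ.isAtom_smul π.1).1 h))
      (Univ.not_isAtom_ofSet _) fun z => ⟨fun hz => ?_, fun hz => ?_⟩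
    · have h1 : π.1⁻¹ • z ϵ s := by
        have := Univ.smul_mem_smul_of_mem π.1⁻¹ hz
        change π.1⁻¹ • z ϵ π.1⁻¹ • π.1 • s at this
        rwa [inv_smul_smul] at this
      have := key π hπ _ h1
      rwa [smul_inv_smul] at this
    · have h1 := key π⁻¹ (fun e he => by
        change (π.1)⁻¹ e = e
        rw [Equiv.Perm.inv_eq_iff_eq, hπ e he]) z hz
      have := Univ.smul_mem_smul_of_mem π.1 h1
      change π.1 • π.1⁻¹ • z ϵ _ at this
      rwa [smul_inv_smul] at this
  refine ⟨⟨s, fun t ht => ?_⟩, Univ.not_isAtom_ofSet _, fun y => ?_⟩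
  · rcases Relation.ReflTransGen.cases_tail ht with h | ⟨y, hty, hy⟩
    · subst h
      exact mem_finiteSupportFilter.2 ⟨E, hE, hs⟩
    · obtain ⟨x, hx, rfl⟩ := Univ.mem_ofSet.1 hy
      exact x.2 t hty
  · exact Univ.mem_ofSet.trans ⟨fun ⟨x, hx, h⟩ => Subtype.ext h ▸ hx, fun h => ⟨y, h, rfl⟩⟩

/-- The atom `a` as an element of the model. -/
def ofAtom (G : Subgroup (Equiv.Perm A)) (a : A) : FinModel G :=
  ⟨Univ.ofAtom a, fun t ht => by
    rcases Relation.ReflTransGen.cases_tail ht with h | ⟨y, -, hy⟩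
    · subst h
      exact mem_finiteSupportFilter.2 ⟨{a}, Set.finite_singleton a, fun π hπ =>
        congrArg Univ.ofAtom (hπ a rfl)⟩
    · exact absurd hy (Univ.not_mem_of_isAtom (Univ.isAtom_ofAtom a))⟩

theorem isAtom_iff {x : FinModel G} : IsAtom x ↔ ∃ a, x = ofAtom G a := by
  refine ⟨fun h => ?_, ?_⟩
  · obtain ⟨a, ha⟩ := Univ.exists_ofAtom (A := A) h
    exact ⟨a, Subtype.ext ha⟩
  · rintro ⟨a, rfl⟩
    exact Univ.isAtom_ofAtom a

theorem ofAtom_injective : Function.Injective (ofAtom G) := fun _ _ h =>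
  Univ.ofAtom_injective (congrArg Subtype.val h)

theorem smul_ofAtom (π : G) (a : A) : π • ofAtom G a = ofAtom G (π.1 a) := rfl

end FinModel

end

section

variable {A : Type u} {G : Subgroup (Equiv.Perm A)}

theorem Supp.inv_elts {E : Set A} {x : FinModel G} (h : Supp G E x) : Inv G E (elts x) := by
  intro π hπ y hy
  have := (FinModel.smul_mem_smul π).2 hy
  rwa [h π hπ] at this

theorem inv_of_forall_supp {X : Type*} [SMul G X] {E : Set A} {K : Set X}
    (h : ∀ x ∈ K, Supp G E x) : Inv G E K := by
  intro π hπ x hx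
  rwa [h x hx π hπ]

theorem fix_inv {E : Set A} {π : G} (hπ : ∀ e ∈ E, π.1 e = e) : ∀ e ∈ E, π⁻¹.1 e = e := by
  intro e he
  change (π.1)⁻¹ e = e
  rw [Equiv.Perm.inv_eq_iff_eq, hπ e he]

namespace FinModel

theorem isSetOf_unique {s t : FinModel G} {K : Set (FinModel G)} (hs : IsSetOf s K)
    (ht : IsSetOf t K) : s = t :=
  ext hs.1 ht.1 fun z => (hs.2 z).trans (ht.2 z).symm

theorem isSetOf_elts {s : FinModel G} (h : IsSet s) : IsSetOf s (elts s) := ⟨h, fun _ => Iff.rfl⟩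

theorem _root_.FM.IsSetOf.elts_eq {V : Type u} [ZFAStructure V] {s : V} {K : Set V}
    (h : IsSetOf s K) : elts s = K := Set.ext h.2

theorem _root_.FM.IsSetOf.supp {E : Set A} {s : FinModel G} {K : Set (FinModel G)}
    (h : IsSetOf s K) (hK : Inv G E K) : Supp G E s := by
  intro π hπ
  refine ext ((isSet_smul π).2 h.1) h.1 fun z => ?_
  rw [← smul_mem_smul π⁻¹, inv_smul_smul, h.2, h.2]
  refine ⟨fun hz => ?_, fun hz => hK _ (fix_inv hπ) _ hz⟩
  have := hK π hπ _ hz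
  rwa [smul_inv_smul] at this

theorem exists_supp_of_finite {K : Set (FinModel G)} (hK : K.Finite) :
    ∃ E : Set A, E.Finite ∧ ∀ x ∈ K, Supp G E x := by
  choose E hE h using fun x : FinModel G => exists_supp x
  exact ⟨⋃ x ∈ K, E x, hK.biUnion fun x _ => hE x,
    fun x hx => (h x).mono (Set.subset_biUnion_of_mem hx)⟩

theorem exists_isSetOf_of_forall_supp (K : Set (FinModel G)) [Small.{u} K] {E : Set A}
    (hE : E.Finite) (h : ∀ x ∈ K, Supp G E x) : ∃ s : FinModel G, IsSetOf s K :=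
  exists_isSetOf K hE (inv_of_forall_supp h)

theorem exists_isSetOf_of_finite {K : Set (FinModel G)} (hK : K.Finite) :
    ∃ s : FinModel G, IsSetOf s K := by
  obtain ⟨E, hE, h⟩ := exists_supp_of_finite hK
  have := hK.to_subtype
  exact exists_isSetOf_of_forall_supp K hE h

theorem isSetOf_smul {s : FinModel G} {K : Set (FinModel G)} (π : G) (h : IsSetOf s K) :
    IsSetOf (π • s) ((fun x => π • x) '' K) := by
  refine ⟨(isSet_smul π).2 h.1, fun y => ?_⟩
  rw [← smul_mem_smul π⁻¹, inv_smul_smul, h.2]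
  exact ⟨fun hy => ⟨_, hy, smul_inv_smul π y⟩, by rintro ⟨x, hx, rfl⟩; rwa [inv_smul_smul]⟩

/-! ### Pairs and relations in the model -/

theorem exists_isOPair (a b : FinModel G) : ∃ p, IsOPair p a b := by
  obtain ⟨s, hs⟩ := exists_isSetOf_of_finite (Set.finite_singleton a)
  obtain ⟨t, ht⟩ := exists_isSetOf_of_finite (Set.toFinite {a, b})
  obtain ⟨p, hp⟩ := exists_isSetOf_of_finite (Set.toFinite {s, t})
  exact ⟨p, s, t, hs, ht, hp⟩

/-- The ordered pair in the model. -/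
noncomputable def opair (a b : FinModel G) : FinModel G := (exists_isOPair a b).choose

theorem isOPair_opair (a b : FinModel G) : IsOPair (opair a b) a b :=
  (exists_isOPair a b).choose_spec

theorem isOPair_iff {p a b : FinModel G} : IsOPair p a b ↔ p = opair a b := by
  refine ⟨fun ⟨s, t, hs, ht, hp⟩ => ?_, fun h => h ▸ isOPair_opair a b⟩
  obtain ⟨s', t', hs', ht', hp'⟩ := isOPair_opair a b
  rw [isSetOf_unique hs' hs, isSetOf_unique ht' ht] at hp'
  exact isSetOf_unique hp hp'

theorem opair_inj {a b c d : FinModel G} : opair a b = opair c d ↔ a = c ∧ b = d := by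
  refine ⟨fun h => ?_, fun ⟨h, k⟩ => h ▸ k ▸ rfl⟩
  obtain ⟨s, t, hs, ht, hp⟩ := isOPair_opair a b
  obtain ⟨s', t', hs', ht', hp'⟩ := isOPair_opair c d
  rw [← h] at hp'
  have := hp.elts_eq.symm.trans hp'.elts_eq
  rcases Set.pair_eq_pair_iff.1 this with ⟨h1, h2⟩ | ⟨h1, h2⟩
  · subst h1 h2
    have h1 := Set.singleton_injective (hs.elts_eq.symm.trans hs'.elts_eq)
    have h2 := Set.pair_eq_pair_iff.1 (ht.elts_eq.symm.trans ht'.elts_eq)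
    subst h1
    grind
  · subst h1 h2
    have h1 := (hs.elts_eq.symm.trans ht'.elts_eq)
    have h2 := (ht.elts_eq.symm.trans hs'.elts_eq)
    have h3 : c ∈ ({a} : Set (FinModel G)) := h1 ▸ Set.mem_insert _ _
    have h4 : d ∈ ({a} : Set (FinModel G)) := h1 ▸ Set.mem_insert_of_mem _ rfl
    have h5 : b ∈ ({c} : Set (FinModel G)) := h2 ▸ Set.mem_insert_of_mem _ rfl
    simp only [Set.mem_singleton_iff] at h3 h4 h5
    subst h3 h4
    exact ⟨rfl, h5⟩

theorem smul_opair (π : G) (a b : FinModel G) : π • opair a b = opair (π • a) (π • b) := by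
  obtain ⟨s, t, hs, ht, hp⟩ := isOPair_opair a b
  refine isOPair_iff.1 ⟨π • s, π • t, ?_, ?_, ?_⟩
  · simpa using isSetOf_smul π hs
  · simpa [Set.image_pair] using isSetOf_smul π ht
  · simpa [Set.image_pair] using isSetOf_smul π hp

theorem rel_iff {r a b : FinModel G} : Rel r a b ↔ opair a b ϵ r :=
  ⟨fun ⟨_, hp, h⟩ => isOPair_iff.1 hp ▸ h, fun h => ⟨_, isOPair_opair a b, h⟩⟩

theorem rel_smul (π : G) {r a b : FinModel G} : Rel (π • r) (π • a) (π • b) ↔ Rel r a b := by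
  rw [rel_iff, rel_iff, ← smul_opair, smul_mem_smul]

theorem _root_.FM.Supp.rel {E : Set A} {r a b : FinModel G} (hr : Supp G E r) {π : G}
    (hπ : ∀ e ∈ E, π.1 e = e) (h : Rel r a b) : Rel r (π • a) (π • b) := by
  have := (rel_smul π).2 h
  rwa [hr π hπ] at this

/-- A small invariant relation is a set of the model. -/
theorem exists_rel (R : FinModel G → FinModel G → Prop) (D C : Set (FinModel G)) [Small.{u} D]
    [Small.{u} C] (hR : ∀ a b, R a b → a ∈ D ∧ b ∈ C) {E : Set A} (hE : E.Finite)
    (h : ∀ π : G, (∀ e ∈ E, π.1 e = e) → ∀ a b, R a b → R (π • a) (π • b)) :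
    ∃ r, IsSetOf r {p | ∃ a b, R a b ∧ p = opair a b} ∧ ∀ a b, Rel r a b ↔ R a b := by
  have : Small.{u} {p | ∃ a b, R a b ∧ p = opair a b} := by
    refine small_subset (s := Set.image2 opair D C) ?_
    rintro _ ⟨a, b, hab, rfl⟩
    exact ⟨a, (hR a b hab).1, b, (hR a b hab).2, rfl⟩
  obtain ⟨r, hr⟩ := exists_isSetOf {p | ∃ a b, R a b ∧ p = opair a b} hE (by
    rintro π hπ _ ⟨a, b, hab, rfl⟩
    exact ⟨_, _, h π hπ a b hab, smul_opair π a b⟩)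
  refine ⟨r, hr, fun a b => ?_⟩
  rw [rel_iff, hr.2]
  constructor
  · rintro ⟨a', b', hab, heq⟩
    obtain ⟨rfl, rfl⟩ := opair_inj.1 heq
    exact hab
  · exact fun hab => ⟨a, b, hab, rfl⟩

theorem _root_.FM.IsMap.exists_fun {f : FinModel G} {D C : Set (FinModel G)} (h : IsMap f D C) :
    ∃ g : FinModel G → FinModel G, Set.MapsTo g D C ∧ ∀ a b, Rel f a b ↔ a ∈ D ∧ g a = b := by
  have key : ∀ a b, Rel f a b → a ∈ D ∧ b ∈ C := by
    intro a b hab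
    obtain ⟨a', ha', b', hb', hp⟩ := h.2.1 _ (rel_iff.1 hab)
    obtain ⟨rfl, rfl⟩ := opair_inj.1 (isOPair_iff.1 hp)
    exact ⟨ha', hb'⟩
  have : ∀ a, ∃ b, a ∈ D → Rel f a b ∧ ∀ b', Rel f a b' → b' = b := by
    intro a
    by_cases ha : a ∈ D
    · exact (h.2.2 a ha).imp fun b hb _ => hb
    · exact ⟨a, fun h => absurd h ha⟩
  choose g hg' using this
  have hg : ∀ a ∈ D, Rel f a (g a) := fun a ha => (hg' a ha).1
  replace hg' := fun a ha => (hg' a ha).2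
  exact ⟨g, fun a ha => (key _ _ (hg a ha)).2, fun a b =>
    ⟨fun hab => ⟨(key _ _ hab).1, (hg' a (key _ _ hab).1 b hab).symm⟩,
      fun ⟨ha, hb⟩ => hb ▸ hg a ha⟩⟩

theorem exists_isMap {D C : Set (FinModel G)} [Small.{u} D] {g : FinModel G → FinModel G}
    (hg : Set.MapsTo g D C) {E : Set A} (hE : E.Finite)
    (h : ∀ π : G, (∀ e ∈ E, π.1 e = e) → ∀ a ∈ D, π • a ∈ D ∧ g (π • a) = π • g a) :
    ∃ f, IsMap f D C ∧ ∀ a b, Rel f a b ↔ a ∈ D ∧ g a = b := by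
  obtain ⟨f, hf, hR⟩ := exists_rel (fun a b => a ∈ D ∧ g a = b) D (g '' D)
    (fun a b ⟨ha, hb⟩ => ⟨ha, a, ha, hb⟩) hE (by
      rintro π hπ a _ ⟨ha, rfl⟩
      exact h π hπ a ha)
  refine ⟨f, ⟨hf.1, ?_, fun a ha => ⟨g a, (hR _ _).2 ⟨ha, rfl⟩, fun b hb => ((hR _ _).1 hb).2.symm⟩⟩,
    hR⟩
  intro p hp
  obtain ⟨a, b, ⟨ha, rfl⟩, rfl⟩ := (hf.2 p).1 hp
  exact ⟨a, ha, _, hg ha, isOPair_opair _ _⟩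

/-! ### Natural numbers in the model -/

theorem exists_isSucc (x : FinModel G) : ∃ s, IsSucc s x := by
  obtain ⟨E, hE, h⟩ := exists_supp x
  have : Small.{u} {z | z ϵ x ∨ z = x} :=
    small_subset (s := elts x ∪ {x}) fun z hz => hz
  refine exists_isSetOf _ hE ?_
  rintro π hπ z (hz | rfl)
  · exact Or.inl (h.inv_elts π hπ z hz)
  · exact Or.inr (h π hπ)

theorem exists_isSetOf_empty : ∃ e : FinModel G, IsSetOf e ∅ :=
  exists_isSetOf_of_finite Set.finite_empty

/-- The von Neumann numerals of the model. -/
noncomputable def num (G : Subgroup (Equiv.Perm A)) : ℕ → FinModel G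
  | 0 => exists_isSetOf_empty.choose
  | k + 1 => (exists_isSucc (num G k)).choose

theorem num_zero : IsSetOf (num G 0) ∅ := exists_isSetOf_empty.choose_spec

theorem num_succ (k : ℕ) : IsSucc (num G (k + 1)) (num G k) :=
  (exists_isSucc (num G k)).choose_spec

theorem smul_num (π : G) (k : ℕ) : π • num G k = num G k := by
  have : Supp G ∅ (num G k) := by
    induction k with
    | zero => exact num_zero.supp fun _ _ _ h => h.elim
    | succ k ih =>
      refine (num_succ k).supp ?_
      rintro π hπ z (hz | rfl)
      · exact Or.inl (ih.inv_elts π hπ z hz)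
      · exact Or.inr (ih π hπ)
  exact this π fun _ h => h.elim

theorem elts_num (k : ℕ) : elts (num G k) = num G '' Set.Iio k := by
  induction k with
  | zero => rw [num_zero.elts_eq]; simp
  | succ k ih =>
    rw [(num_succ k).elts_eq, ← Order.succ_eq_add_one, Order.Iio_succ_eq_insert, Set.image_insert_eq, ← ih]
    ext z
    exact or_comm

theorem not_mem_self (x : FinModel G) : ¬ x ϵ x := fun h =>
  mem_wf.irrefl.irrefl x h

theorem num_injective : Function.Injective (num G) := by
  have key : ∀ i j, i < j → num G i ≠ num G j := by
    intro i j hij h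
    have : num G i ∈ elts (num G j) := by
      rw [elts_num]
      exact ⟨i, hij, rfl⟩
    rw [h] at this
    exact not_mem_self _ this
  intro i j h
  rcases lt_trichotomy i j with hij | hij | hij
  · exact absurd h (key _ _ hij)
  · exact hij
  · exact absurd h.symm (key _ _ hij)

theorem exists_isInductiveSet : ∃ w : FinModel G, IsInductiveSet w ∧ IsSetOf w (Set.range (num G)) := by
  obtain ⟨w, hw⟩ := exists_isSetOf (Set.range (num G)) (E := ∅) Set.finite_empty (by
    rintro π - _ ⟨k, rfl⟩
    exact ⟨k, (smul_num π k).symm⟩)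
  refine ⟨w, ⟨hw.1, ⟨_, num_zero, (hw.2 _).2 ⟨0, rfl⟩⟩, fun x hx => ?_⟩, hw⟩
  obtain ⟨k, rfl⟩ := (hw.2 x).1 hx
  exact ⟨_, num_succ k, (hw.2 _).2 ⟨k + 1, rfl⟩⟩

theorem omega_eq : omega (FinModel G) = Set.range (num G) := by
  refine Set.Subset.antisymm (fun n hn => ?_) ?_
  · obtain ⟨w, hw, hw'⟩ := exists_isInductiveSet (G := G)
    exact (hw'.2 n).1 (hn w hw)
  · rintro _ ⟨k, rfl⟩ w hw
    induction k with
    | zero =>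
      obtain ⟨e, he, hew⟩ := hw.2.1
      rwa [isSetOf_unique num_zero he]
    | succ k ih =>
      obtain ⟨s, hs, hsw⟩ := hw.2.2 _ ih
      rwa [isSetOf_unique (num_succ k) hs]

theorem isFin_iff {x : FinModel G} : IsFin x ↔ IsSet x ∧ (elts x).Finite := by
  constructor
  · rintro ⟨hx, k, hk, f, ⟨hf, hinj⟩, -⟩
    rw [omega_eq] at hk
    obtain ⟨k, rfl⟩ := hk
    obtain ⟨g, hg, hR⟩ := hf.exists_fun
    refine ⟨hx, Set.Finite.of_injOn hg (fun a ha b hb hab => ?_) ?_⟩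
    · exact hinj a b (g a) ((hR _ _).2 ⟨ha, rfl⟩) ((hR _ _).2 ⟨hb, hab.symm⟩)
    · rw [elts_num]
      exact (Set.finite_Iio k).image _
  · rintro ⟨hx, hfin⟩
    have := hfin.to_subtype
    obtain ⟨k, ⟨e⟩⟩ := Finite.exists_equiv_fin (elts x)
    classical
    let g : FinModel G → FinModel G := fun a => if h : a ∈ elts x then num G (e ⟨a, h⟩) else a
    have hgx : ∀ a (h : a ∈ elts x), g a = num G (e ⟨a, h⟩) := fun a h => dif_pos h
    obtain ⟨E, hE, hsupp⟩ := exists_supp_of_finite hfin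
    obtain ⟨f, hf, hR⟩ := exists_isMap (D := elts x) (C := elts (num G k)) (g := g)
      (fun a ha => by
        rw [hgx a ha, elts_num]
        exact ⟨_, (e ⟨a, ha⟩).2, rfl⟩) hE (fun π hπ a ha => by
        rw [hsupp a ha π hπ, hgx a ha, smul_num]
        exact ⟨ha, rfl⟩)
    refine ⟨hx, num G k, by rw [omega_eq]; exact ⟨k, rfl⟩, f, ⟨hf, ?_⟩, ?_⟩
    · intro a a' b h h'
      obtain ⟨ha, hb⟩ := (hR _ _).1 h
      obtain ⟨ha', hb'⟩ := (hR _ _).1 h'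
      rw [← hb', hgx _ ha, hgx _ ha'] at hb
      simpa using e.injective (Fin.ext (num_injective hb))
    · intro b hb
      rw [elts_num] at hb
      obtain ⟨i, hi, rfl⟩ := hb
      refine ⟨(e.symm ⟨i, hi⟩).1, (hR _ _).2 ⟨(e.symm ⟨i, hi⟩).2, ?_⟩⟩
      rw [hgx _ (e.symm ⟨i, hi⟩).2]
      simp

theorem isInf_iff {x : FinModel G} : IsInf x ↔ IsSet x ∧ (elts x).Infinite := by
  unfold IsInf
  rw [isFin_iff]
  constructor
  · exact fun ⟨h, k⟩ => ⟨h, fun hfin => k ⟨h, hfin⟩⟩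
  · exact fun ⟨h, k⟩ => ⟨h, fun hfin => k hfin.2⟩

theorem isUncountable_of_not_countable {x : FinModel G} (hx : IsSet x)
    (h : ¬ (elts x).Countable) : IsUncountable x := by
  refine ⟨hx, fun ⟨_, f, hf, hinj⟩ => h ?_⟩
  obtain ⟨g, hg, hR⟩ := hf.exists_fun
  refine Set.MapsTo.countable_of_injOn hg (fun a ha b hb hab => ?_) ?_
  · exact hinj a b (g a) ((hR _ _).2 ⟨ha, rfl⟩) ((hR _ _).2 ⟨hb, hab.symm⟩)
  · rw [omega_eq]
    exact Set.countable_range _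

theorem not_countable_of_isUncountable {x : FinModel G} (h : IsUncountable x) {E : Set A}
    (hE : E.Finite) (hsupp : ∀ y, y ϵ x → Supp G E y) : ¬ (elts x).Countable := by
  intro hc
  obtain ⟨i, hi⟩ := Set.countable_iff_exists_injOn.1 hc
  obtain ⟨f, hf, hR⟩ := exists_isMap (D := elts x) (C := omega (FinModel G))
    (g := fun a => num G (i a)) (fun a _ => by rw [omega_eq]; exact ⟨_, rfl⟩) hE
    (fun π hπ a ha => by
      rw [hsupp a ha π hπ, smul_num]
      exact ⟨ha, rfl⟩)
  refine h.2 ⟨h.1, f, hf, fun a a' b h h' => ?_⟩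
  obtain ⟨ha, hb⟩ := (hR _ _).1 h
  obtain ⟨ha', hb'⟩ := (hR _ _).1 h'
  exact hi ha ha' (num_injective (hb.trans hb'.symm))

/-! ### The axioms -/

/-- An element of the group is an automorphism of the model. -/
def smulEquiv (π : G) : zfaLang.Equiv (FinModel G) (FinModel G) where
  toEquiv := MulAction.toPerm π
  map_fun' f := nomatch f
  map_rel' := by
    intro k r v
    cases r with
    | atom => exact isAtom_smul π
    | mem => exact smul_mem_smul π

theorem realize_smul {α : Type} (π : G) (φ : zfaLang.Formula α) (v : α → FinModel G) :
    φ.Realize (fun i => π • v i) ↔ φ.Realize v :=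
  FirstOrder.Language.StrongHomClass.realize_formula (smulEquiv π) φ

theorem isZFA (G : Subgroup (Equiv.Perm A)) : IsZFA (FinModel G) where
  atom_empty a x h := not_mem_of_isAtom h
  atoms := by
    have : Small.{u} {x : FinModel G | IsAtom x} :=
      small_subset (s := Set.range (ofAtom G)) fun x hx => by
        obtain ⟨a, rfl⟩ := isAtom_iff.1 hx
        exact ⟨a, rfl⟩
    exact exists_isSetOf _ Set.finite_empty fun π _ x hx => (isAtom_smul π).2 hx
  ext x y := ext
  empty := exists_isSetOf_empty
  pairing a b := exists_isSetOf_of_finite (Set.toFinite _)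
  union x := by
    obtain ⟨E, hE, h⟩ := exists_supp x
    have : Small.{u} {z | ∃ y, y ϵ x ∧ z ϵ y} :=
      small_subset (s := ⋃ y : elts x, elts y.1) fun z ⟨y, hy, hz⟩ => Set.mem_iUnion.2 ⟨⟨y, hy⟩, hz⟩
    refine exists_isSetOf _ hE ?_
    rintro π hπ z ⟨y, hy, hz⟩
    exact ⟨_, h.inv_elts π hπ y hy, (smul_mem_smul π).2 hz⟩
  powerset x hx := by
    obtain ⟨E, hE, h⟩ := exists_supp x
    have : Small.{u} {y | IsSubset y x} := by
      refine small_of_injective (β := 𝒫 (elts x)) (f := fun y => ⟨elts y.1, y.2.2⟩) fun y z hyz => ?_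
      have : elts y.1 = elts z.1 := congrArg Subtype.val hyz
      exact Subtype.ext (ext y.2.1 z.2.1 fun t => Set.ext_iff.1 this t)
    refine exists_isSetOf _ hE ?_
    rintro π hπ y ⟨hy, hyx⟩
    refine ⟨(isSet_smul π).2 hy, fun z hz => ?_⟩
    have := (smul_mem_smul π⁻¹).2 hz
    rw [inv_smul_smul] at this
    have := h.inv_elts π hπ _ (hyx _ this)
    rwa [smul_inv_smul] at this
  infinity := exists_isInductiveSet.imp fun _ h => h.1
  foundation x := fun ⟨y, hy⟩ => by
    obtain ⟨z, hz, hmin⟩ := mem_wf.has_min (elts x) ⟨y, hy⟩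
    exact ⟨z, hz, fun t ht htx => hmin t htx ht⟩
  separation k φ p x := by
    obtain ⟨E, hE, h⟩ := exists_supp_of_finite ((Set.finite_range p).insert x)
    have : Small.{u} {y | y ϵ x ∧ φ.Realize (Sum.elim p ![y])} :=
      small_subset (s := elts x) fun y hy => hy.1
    refine exists_isSetOf _ hE ?_
    rintro π hπ y ⟨hy, hφ⟩
    refine ⟨(h x (Set.mem_insert _ _)).inv_elts π hπ y hy, ?_⟩
    rw [← realize_smul π] at hφ
    convert hφ using 1
    funext i
    rcases i with i | i
    · exact (h (p i) (Set.mem_insert_of_mem _ ⟨i, rfl⟩) π hπ).symm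
    · obtain rfl := Subsingleton.elim i 0
      rfl
  replacement k φ p x hfun := by
    obtain ⟨E, hE, h⟩ := exists_supp_of_finite ((Set.finite_range p).insert x)
    have : Small.{u} {z | ∃ y, y ϵ x ∧ φ.Realize (Sum.elim p ![y, z])} := by
      classical
      let g : elts x → FinModel G := fun y =>
        if hz : ∃ z, φ.Realize (Sum.elim p ![y.1, z]) then hz.choose else x
      refine small_subset (s := Set.range g) ?_
      rintro z ⟨y, hy, hφ⟩
      refine ⟨⟨y, hy⟩, ?_⟩
      have hz : ∃ z, φ.Realize (Sum.elim p ![y, z]) := ⟨z, hφ⟩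
      exact (dif_pos hz).trans (hfun y _ _ hy hz.choose_spec hφ)
    refine exists_isSetOf _ hE ?_
    rintro π hπ z ⟨y, hy, hφ⟩
    refine ⟨π • y, (h x (Set.mem_insert _ _)).inv_elts π hπ y hy, ?_⟩
    rw [← realize_smul π] at hφ
    convert hφ using 1
    funext i
    rcases i with i | i
    · exact (h (p i) (Set.mem_insert_of_mem _ ⟨i, rfl⟩) π hπ).symm
    · fin_cases i <;> rfl

end FinModel

end

theorem exists_infinite_polychromatic_subset {β C : Type*} {S : Set β} (hS : S.Infinite)
    (m n : ℕ) (χ : Finset β → C)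
    (hχ : ∀ c, {s : Finset β | (s : Set β) ⊆ S ∧ s.card = m ∧ χ s = c}.encard ≤ n) :
    ∃ Y ⊆ S, Y.Infinite ∧ ∀ s t : Finset β, (s : Set β) ⊆ Y → (t : Set β) ⊆ Y →
      s.card = m → t.card = m → χ s = χ t → s = t := by
  have := hS.to_subtype
  let i : S ↪ β := Function.Embedding.subtype _
  obtain ⟨Y, hY, h⟩ := exists_infinite_polychromatic m n (fun s : Finset S => χ (s.map i)) (by
    refine fun c => (Set.encard_le_encard_of_injOn (f := Finset.map i) ?_
      (Finset.map_injective i).injOn).trans (hχ c)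
    rintro s ⟨hs, hc⟩
    refine ⟨fun z hz => ?_, by rwa [Finset.card_map], hc⟩
    obtain ⟨y, -, rfl⟩ := Finset.mem_map.1 hz
    exact y.2)
  refine ⟨i '' Y, ?_, hY.image i.injective.injOn, fun s t hs ht hsm htm hst => ?_⟩
  · rintro _ ⟨y, -, rfl⟩
    exact y.2
  · classical
    obtain ⟨s, hs', rfl⟩ := Finset.subset_set_image_iff.1 hs
    obtain ⟨t, ht', rfl⟩ := Finset.subset_set_image_iff.1 ht
    rw [Finset.card_image_of_injective _ i.injective] at hsm htm
    rw [← Finset.map_eq_image, ← Finset.map_eq_image] at hst ⊢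
    rw [h s t hs' ht' hsm htm hst]

section

variable {A : Type u} {G : Subgroup (Equiv.Perm A)}

/-- The orbit of the atom `a` under the elements of `G` that fix every atom in `E`. -/
def orb (G : Subgroup (Equiv.Perm A)) (E : Set A) (a : A) : Set A :=
  {c | ∃ π : G, (∀ e ∈ E, π.1 e = e) ∧ π.1 a = c}

theorem self_mem_orb (E : Set A) (a : A) : a ∈ orb G E a := ⟨1, fun _ _ => rfl, rfl⟩

theorem smul_mem_orb {E : Set A} {a c : A} {π : G} (hπ : ∀ e ∈ E, π.1 e = e)
    (hc : c ∈ orb G E a) : π.1 c ∈ orb G E a := by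
  obtain ⟨ρ, hρ, rfl⟩ := hc
  exact ⟨π * ρ, fun e he => (congrArg π.1 (hρ e he)).trans (hπ e he), rfl⟩

theorem notMem_of_mem_orb {E : Set A} {a c : A} (ha : a ∉ E) (hc : c ∈ orb G E a) : c ∉ E := by
  rintro h
  obtain ⟨π, hπ, rfl⟩ := hc
  exact ha (π.1.injective (hπ _ h) ▸ h)

/-- The pointwise stabilizers of finite sets of atoms have infinite orbits, and they become maximal
subgroups of themselves when one more atom is fixed. -/
structure Flexible (G : Subgroup (Equiv.Perm A)) : Prop where
  infinite_orb : ∀ E : Set A, E.Finite → ∀ b ∉ E, (orb G E b).Infinite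
  maximal : ∀ E : Set A, E.Finite → ∀ a ∉ E, ∀ H : Subgroup G,
    (∀ π : G, (∀ e ∈ insert a E, π.1 e = e) → π ∈ H) →
    (∃ π ∈ H, (∀ e ∈ E, π.1 e = e) ∧ π.1 a ≠ a) →
    ∀ π : G, (∀ e ∈ E, π.1 e = e) → π ∈ H

theorem Flexible.fix_of_smul_eq {X : Type*} [MulAction G X] (hG : Flexible G) {E : Set A}
    (hE : E.Finite) {a : A} (ha : a ∉ E) {x : X} (h1 : Supp G (insert a E) x)
    (h2 : ¬ Supp G E x) {π : G} (hπ : ∀ e ∈ E, π.1 e = e) (hx : π • x = x) : π.1 a = a := by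
  by_contra hne
  exact h2 fun ρ hρ => hG.maximal E hE a ha (MulAction.stabilizer G x) (fun σ hσ => h1 σ hσ)
    ⟨π, hx, hπ, hne⟩ ρ hρ

theorem exists_supp_insert {X : Type*} [SMul G X] {x : X} {E S : Set A} (hE : E.Finite)
    (hS : S.Finite) (hx : Supp G (E ∪ S) x) (h : ¬ Supp G E x) :
    ∃ E' : Set A, E ⊆ E' ∧ E'.Finite ∧ ∃ a ∉ E', Supp G (insert a E') x ∧ ¬ Supp G E' x := by
  induction S, hS using Set.Finite.induction_on with
  | empty => exact absurd (by simpa using hx) h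
  | @insert a S _ hS ih =>
    by_cases h' : Supp G (E ∪ S) x
    · exact ih h'
    · rw [Set.union_insert] at hx
      refine ⟨E ∪ S, Set.subset_union_left, hE.union hS, a, fun ha => h' ?_, hx, h'⟩
      rwa [Set.insert_eq_of_mem ha] at hx

/-- An element that is not supported by `E` yields an injective equivariant image of an orbit of
atoms. -/
theorem Flexible.exists_orbit_map (hG : Flexible G) {E : Set A} (hE : E.Finite) {x : FinModel G}
    (hx : ¬ Supp G E x) :
    ∃ E' : Set A, E ⊆ E' ∧ E'.Finite ∧ ∃ a ∉ E', ∃ h : A → FinModel G, h a = x ∧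
      Set.InjOn h (orb G E' a) ∧
      ∀ π : G, (∀ e ∈ E', π.1 e = e) → ∀ c ∈ orb G E' a, h (π.1 c) = π • h c := by
  obtain ⟨S, hS, hxS⟩ := FinModel.exists_supp x
  obtain ⟨E', hEE', hE', a, ha, h1, h2⟩ :=
    exists_supp_insert hE hS (hxS.mono Set.subset_union_right) hx
  classical
  let h : A → FinModel G := fun c => if hc : c ∈ orb G E' a then hc.choose • x else x
  have key : ∀ π : G, (∀ e ∈ E', π.1 e = e) → h (π.1 a) = π • x := by
    intro π hπ
    have hc : π.1 a ∈ orb G E' a := ⟨π, hπ, rfl⟩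
    have hρ := hc.choose_spec
    rw [show h (π.1 a) = hc.choose • x from dif_pos hc, ← inv_smul_eq_iff, ← mul_smul]
    refine h1 _ fun e he => ?_
    change (π.1)⁻¹ (hc.choose.1 e) = e
    rw [Equiv.Perm.inv_eq_iff_eq]
    rcases he with rfl | he
    · exact hρ.2
    · rw [hρ.1 e he, hπ e he]
  refine ⟨E', hEE', hE', a, ha, h, ?_, ?_, ?_⟩
  · simpa using key 1 fun _ _ => rfl
  · rintro _ ⟨π, hπ, rfl⟩ _ ⟨ρ, hρ, rfl⟩ heq
    rw [key π hπ, key ρ hρ, ← inv_smul_eq_iff, ← mul_smul] at heq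
    have := hG.fix_of_smul_eq hE' ha h1 h2 (π := ρ⁻¹ * π)
      (fun e he => (congrArg (ρ⁻¹).1 (hπ e he)).trans (fix_inv hρ e he)) heq
    change (ρ.1)⁻¹ (π.1 a) = a at this
    rwa [Equiv.Perm.inv_eq_iff_eq] at this
  · rintro π hπ _ ⟨ρ, hρ, rfl⟩
    rw [key ρ hρ, ← mul_smul]
    exact key (π * ρ) fun e he => (congrArg π.1 (hρ e he)).trans (hπ e he)

namespace FinModel

/-- The finite set of the model with the given elements. -/
noncomputable def ofFinset (s : Finset (FinModel G)) : FinModel G :=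
  (exists_isSetOf_of_finite s.finite_toSet).choose

theorem isSetOf_ofFinset (s : Finset (FinModel G)) : IsSetOf (ofFinset s) (s : Set (FinModel G)) :=
  (exists_isSetOf_of_finite s.finite_toSet).choose_spec

theorem ofFinset_injective : Function.Injective (ofFinset (G := G)) := fun s t h => by
  have := (isSetOf_ofFinset s).elts_eq
  rw [h, (isSetOf_ofFinset t).elts_eq] at this
  exact (Finset.coe_injective this).symm

theorem eq_ofFinset {x : FinModel G} (hx : IsSet x) (h : (elts x).Finite) :
    x = ofFinset h.toFinset :=
  isSetOf_unique (isSetOf_elts hx) (by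
    have := isSetOf_ofFinset h.toFinset
    rwa [h.coe_toFinset] at this)

theorem eq_ofFinset_of_mem_subsetsOfCard {m : ℕ} {X s : FinModel G}
    (hs : s ∈ subsetsOfCard m X) :
    ∃ t : Finset (FinModel G), s = ofFinset t ∧ t.card = m ∧ (t : Set (FinModel G)) ⊆ elts X := by
  have hfin : (elts s).Finite := Set.finite_of_encard_eq_coe hs.2
  refine ⟨hfin.toFinset, eq_ofFinset hs.1.1 hfin, ?_, ?_⟩
  · have := hs.2
    rw [hfin.encard_eq_coe_toFinset_card] at this
    exact_mod_cast this
  · rw [hfin.coe_toFinset]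
    exact hs.1.2

theorem ofFinset_mem_subsetsOfCard {m : ℕ} {X : FinModel G} {t : Finset (FinModel G)}
    (ht : (t : Set (FinModel G)) ⊆ elts X) (hm : t.card = m) :
    ofFinset t ∈ subsetsOfCard m X := by
  refine ⟨⟨(isSetOf_ofFinset t).1, fun z hz => ht (((isSetOf_ofFinset t).2 z).1 hz)⟩, ?_⟩
  rw [(isSetOf_ofFinset t).elts_eq, Set.encard_coe_eq_coe_finsetCard, hm]

theorem rrt_of_forall_supp {m n : ℕ} {X C χ : FinModel G} (hX : IsInf X)
    (hχ : IsMap χ (subsetsOfCard m X) (elts C)) (hn : ∀ c, c ϵ C → {s | Rel χ s c}.encard ≤ n)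
    {E : Set A} (hE : E.Finite) (hsupp : ∀ y, y ϵ X → Supp G E y) :
    ∃ Y : FinModel G, IsSubset Y X ∧ IsInf Y ∧
      ∀ s ∈ subsetsOfCard m Y, ∀ t ∈ subsetsOfCard m Y, ∀ c, Rel χ s c → Rel χ t c → s = t := by
  obtain ⟨g, hg, hR⟩ := hχ.exists_fun
  obtain ⟨Y, hYX, hY, hinj⟩ := exists_infinite_polychromatic_subset (isInf_iff.1 hX).2 m n
    (fun s => g (ofFinset s)) (by
      intro c
      by_cases hc : c ϵ C
      · refine (Set.encard_le_encard_of_injOn (f := ofFinset) ?_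
          ofFinset_injective.injOn).trans (hn c hc)
        rintro s ⟨hs, hm, hsc⟩
        exact (hR _ _).2 ⟨ofFinset_mem_subsetsOfCard hs hm, hsc⟩
      · refine (Set.encard_eq_zero.2 ?_).trans_le zero_le
        refine Set.eq_empty_of_forall_notMem fun s hs => hc ?_
        have := hg (ofFinset_mem_subsetsOfCard hs.1 hs.2.1)
        rwa [hs.2.2] at this)
  have : Small.{u} Y := small_subset hYX
  obtain ⟨Z, hZ⟩ := exists_isSetOf_of_forall_supp Y hE fun y hy => hsupp y (hYX hy)
  refine ⟨Z, ⟨hZ.1, fun z hz => hYX ((hZ.2 z).1 hz)⟩, isInf_iff.2 ⟨hZ.1, by rwa [hZ.elts_eq]⟩, ?_⟩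
  intro s hs t ht c hsc htc
  obtain ⟨s, rfl, hsm, hsY⟩ := eq_ofFinset_of_mem_subsetsOfCard hs
  obtain ⟨t, rfl, htm, htY⟩ := eq_ofFinset_of_mem_subsetsOfCard ht
  rw [hZ.elts_eq] at hsY htY
  rw [hinj s t hsY htY hsm htm (((hR _ _).1 hsc).2.trans ((hR _ _).1 htc).2.symm)]

/-- The rainbow Ramsey theorem in the permutation models of flexible groups. -/
theorem rrt (hG : Flexible G) (m n : ℕ) : RRT m n (FinModel G) := by
  intro X C χ hX _ hχ hn
  obtain ⟨E, hE, hsupp⟩ := exists_supp_of_finite (Set.toFinite {X, χ})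
  have hEX : Supp G E X := hsupp X (Set.mem_insert _ _)
  have hEχ : Supp G E χ := hsupp χ (Set.mem_insert_of_mem _ rfl)
  by_cases hall : ∀ y, y ϵ X → Supp G E y
  · exact rrt_of_forall_supp hX hχ hn hE hall
  push Not at hall
  obtain ⟨x, hxX, hx⟩ := hall
  obtain ⟨E', hEE', hE', a, ha, h, rfl, hinj, hequi⟩ := hG.exists_orbit_map hE hx
  obtain ⟨g, hg, hR⟩ := hχ.exists_fun
  have hYX : h '' orb G E' a ⊆ elts X := by
    rintro _ ⟨c, hc, rfl⟩
    obtain ⟨π, hπ, rfl⟩ := hc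
    rw [hequi π hπ a (self_mem_orb _ _)]
    exact hEX.inv_elts π (fun e he => hπ e (hEE' he)) _ hxX
  have : Small.{u} (h '' orb G E' a) := small_subset hYX
  obtain ⟨Y, hY⟩ := exists_isSetOf (h '' orb G E' a) hE' (by
    rintro π hπ _ ⟨c, hc, rfl⟩
    exact ⟨_, smul_mem_orb hπ hc, hequi π hπ c hc⟩)
  refine ⟨Y, ⟨hY.1, fun z hz => hYX ((hY.2 z).1 hz)⟩, isInf_iff.2 ⟨hY.1, ?_⟩, ?_⟩
  · rw [hY.elts_eq]
    exact (hG.infinite_orb E' hE' a ha).image hinj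
  intro s hs t ht c hsc htc
  by_contra hne
  have hsfin : (elts s).Finite := Set.finite_of_encard_eq_coe hs.2
  have htfin : (elts t).Finite := Set.finite_of_encard_eq_coe ht.2
  have hyex : ∃ y, y ϵ t ∧ ¬ y ϵ s := by
    by_contra! hsub
    have hsub' : elts t ⊆ elts s := hsub
    have := htfin.eq_of_subset_of_encard_le hsub' (by rw [hs.2, ht.2])
    exact hne (ext hs.1.1 ht.1.1 fun z => (Set.ext_iff.1 this z).symm)
  obtain ⟨y, hyt, hys⟩ := hyex
  obtain ⟨b, hb, rfl⟩ := (hY.2 y).1 (ht.1.2 y hyt)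
  let B : Set A := {d ∈ orb G E' a | h d ϵ s}
  have hB : B.Finite :=
    Set.Finite.of_finite_image (hsfin.subset (by rintro _ ⟨d, hd, rfl⟩; exact hd.2))
      (hinj.mono (Set.sep_subset _ _))
  have hbE : b ∉ E' ∪ B := by
    rintro (h1 | h1)
    · exact notMem_of_mem_orb ha hb h1
    · exact hys h1.2
  have hT : {s | Rel χ s c}.Finite :=
    Set.finite_of_encard_le_coe (hn c (by
      obtain ⟨hsD, rfl⟩ := (hR _ _).1 hsc
      exact hg hsD))
  have hU : (⋃ t' ∈ {s | Rel χ s c}, elts t').Finite := by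
    refine hT.biUnion fun t' ht' => ?_
    exact Set.finite_of_encard_eq_coe ((hR _ _).1 ht').1.2
  refine hG.infinite_orb (E' ∪ B) (hE'.union hB) b hbE ?_
  refine Set.Finite.of_finite_image (f := h) (hU.subset ?_) (hinj.mono ?_)
  · rintro _ ⟨_, ⟨π, hπ, rfl⟩, rfl⟩
    have hπE' : ∀ e ∈ E', π.1 e = e := fun e he => hπ e (Or.inl he)
    have hπs : π • s = s := by
      refine ((isSetOf_elts hs.1.1).supp (E := E' ∪ B) (inv_of_forall_supp ?_)) π hπ
      intro z hz ρ hρ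
      obtain ⟨d, hd, rfl⟩ := (hY.2 z).1 (hs.1.2 z hz)
      rw [← hequi ρ (fun e he => hρ e (Or.inl he)) d hd, hρ d (Or.inr ⟨hd, hz⟩)]
    have hπE : ∀ e ∈ E, π.1 e = e := fun e he => hπE' e (hEE' he)
    have h1 := hEχ.rel hπE hsc
    have h2 := hEχ.rel hπE htc
    rw [hπs] at h1
    rw [((hR _ _).1 h1).2.symm.trans ((hR _ _).1 hsc).2] at h2
    refine Set.mem_biUnion h2 ?_
    rw [hequi π hπE' b hb]
    exact (smul_mem_smul π).2 hyt
  · rintro _ ⟨π, hπ, rfl⟩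
    exact smul_mem_orb (fun e he => hπ e (Or.inl he)) hb

/-- A finite set supports nothing more than its elements. -/
theorem _root_.FM.Flexible.supp_of_mem (hG : Flexible G) {E : Set A} (hE : E.Finite)
    {x z : FinModel G} (hx : Supp G E x) (hfin : (elts x).Finite) (hz : z ϵ x) : Supp G E z := by
  by_contra hcon
  obtain ⟨E', hEE', hE', a, ha, h, rfl, hinj, hequi⟩ := hG.exists_orbit_map hE hcon
  refine (hG.infinite_orb E' hE' a ha) (Set.Finite.of_finite_image (hfin.subset ?_) hinj)
  rintro _ ⟨_, ⟨π, hπ, rfl⟩, rfl⟩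
  rw [hequi π hπ a (self_mem_orb _ _)]
  exact hx.inv_elts π (fun e he => hπ e (hEE' he)) _ hz

theorem deltaSL_of_forall_supp {F : FinModel G} (hF : IsUncountable F)
    (hfin : ∀ x, x ϵ F → IsFin x) {E : Set A} (hE : E.Finite)
    (hsupp : ∀ y, y ϵ F → Supp G E y) :
    ∃ B, IsSubset B F ∧ IsUncountable B ∧ IsDeltaSystem B := by
  classical
  have hnc := not_countable_of_isUncountable hF hE hsupp
  obtain ⟨B, hBF, hB, r, hr⟩ := exists_delta {s : Finset (FinModel G) | ofFinset s ϵ F} (by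
    intro hc
    refine hnc ((hc.image ofFinset).mono fun y hy => ?_)
    have hy' := isFin_iff.1 (hfin y hy)
    have := eq_ofFinset hy'.1 hy'.2
    refine ⟨hy'.2.toFinset, ?_, this.symm⟩
    change ofFinset _ ϵ F
    rwa [← this])
  have hsub : ofFinset '' B ⊆ elts F := by
    rintro _ ⟨s, hs, rfl⟩
    exact hBF hs
  have : Small.{u} (ofFinset '' B) := small_subset hsub
  obtain ⟨B', hB'⟩ := exists_isSetOf_of_forall_supp (ofFinset '' B) hE fun y hy => hsupp y (hsub hy)
  refine ⟨B', ⟨hB'.1, fun z hz => hsub ((hB'.2 z).1 hz)⟩,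
    isUncountable_of_not_countable hB'.1 fun hc => hB ?_, ofFinset r, (isSetOf_ofFinset r).1, ?_⟩
  · rw [hB'.elts_eq] at hc
    exact Set.countable_of_injective_of_countable_image ofFinset_injective.injOn hc
  · intro x y hx hy hxy z
    obtain ⟨s, hs, rfl⟩ := (hB'.2 x).1 hx
    obtain ⟨t, ht, rfl⟩ := (hB'.2 y).1 hy
    rw [(isSetOf_ofFinset s).2, (isSetOf_ofFinset t).2, (isSetOf_ofFinset r).2,
      ← hr s hs t ht fun hst => hxy (by rw [hst]), Finset.coe_inter]
    exact Iff.rfl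

/-- The `Δ`-system lemma in the permutation models of flexible groups. -/
theorem deltaSL (hG : Flexible G) : DeltaSL (FinModel G) := by
  intro F hF hfin
  obtain ⟨E, hE, hEF⟩ := exists_supp F
  by_cases hall : ∀ y, y ϵ F → Supp G E y
  · exact deltaSL_of_forall_supp hF hfin hE hall
  push Not at hall
  obtain ⟨x, hxF, hx⟩ := hall
  obtain ⟨E', hEE', hE', a, ha, h, rfl, hinj, hequi⟩ := hG.exists_orbit_map hE hx
  have hYF : h '' orb G E' a ⊆ elts F := by
    rintro _ ⟨_, ⟨π, hπ, rfl⟩, rfl⟩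
    rw [hequi π hπ a (self_mem_orb _ _)]
    exact hEF.inv_elts π (fun e he => hπ e (hEE' he)) _ hxF
  have : Small.{u} (h '' orb G E' a) := small_subset hYF
  obtain ⟨Y, hY⟩ := exists_isSetOf (h '' orb G E' a) hE' (by
    rintro π hπ _ ⟨c, hc, rfl⟩
    exact ⟨_, smul_mem_orb hπ hc, hequi π hπ c hc⟩)
  have hfin' : ∀ c ∈ orb G E' a, (elts (h c)).Finite := fun c hc =>
    (isFin_iff.1 (hfin _ (hYF ⟨c, hc, rfl⟩))).2
  refine ⟨Y, ⟨hY.1, fun z hz => hYF ((hY.2 z).1 hz)⟩, ⟨hY.1, ?_⟩, ?_⟩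
  · rintro ⟨_, f, hf, hfinj⟩
    obtain ⟨g, hg, hR⟩ := hf.exists_fun
    obtain ⟨S, hS, hfS⟩ := exists_supp f
    obtain ⟨b, hb, hbS⟩ := (hG.infinite_orb E' hE' a ha).exists_notMem_finite hS
    have hbE : b ∉ E' ∪ S := by
      rintro (h1 | h1)
      · exact notMem_of_mem_orb ha hb h1
      · exact hbS h1
    obtain ⟨_, ⟨π, hπ, rfl⟩, hne⟩ :=
      (hG.infinite_orb _ (hE'.union hS) b hbE).exists_notMem_finite (Set.finite_singleton b)
    have hD : h b ∈ elts Y := (hY.2 _).2 ⟨b, hb, rfl⟩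
    have h1 : Rel f (h b) (g (h b)) := (hR _ _).2 ⟨hD, rfl⟩
    have h2 := hfS.rel (fun e he => hπ e (Or.inr he)) h1
    have hk : π • g (h b) = g (h b) := by
      have := hg hD
      rw [omega_eq] at this
      obtain ⟨k, hk⟩ := this
      rw [← hk, smul_num]
    have hπE' : ∀ e ∈ E', π.1 e = e := fun e he => hπ e (Or.inl he)
    rw [hk, ← hequi π hπE' b hb] at h2
    exact hne (hinj (smul_mem_orb hπE' hb) hb (hfinj _ _ _ h2 h1))
  · obtain ⟨r, hr⟩ := exists_isSetOf_of_finite (K := {z | z ϵ h a ∧ Supp G E' z})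
      ((hfin' a (self_mem_orb _ _)).subset fun z hz => hz.1)
    have hsuppc : ∀ c ∈ orb G E' a, Supp G (insert c E') (h c) := by
      intro c hc π hπ
      rw [← hequi π (fun e he => hπ e (Or.inr he)) c hc, hπ c (Or.inl rfl)]
    refine ⟨r, hr.1, fun y y' hy hy' hyy' z => ?_⟩
    obtain ⟨b, hb, rfl⟩ := (hY.2 y).1 hy
    obtain ⟨c, hc, rfl⟩ := (hY.2 y').1 hy'
    have mem_iff : ∀ d ∈ orb G E' a, Supp G E' z → (z ϵ h d ↔ z ϵ h a) := by
      rintro _ ⟨π, hπ, rfl⟩ hz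
      have := smul_mem_smul π (x := z) (y := h a)
      rwa [hz π hπ, ← hequi π hπ a (self_mem_orb _ _)] at this
    rw [hr.2]
    constructor
    · rintro ⟨hzb, hzc⟩
      have hz : Supp G E' z := by
        by_contra hcon
        have hzb' := hG.supp_of_mem (hE'.insert b) (hsuppc b hb) (hfin' b hb) hzb
        have hzc' := hG.supp_of_mem (hE'.insert c) (hsuppc c hc) (hfin' c hc) hzc
        have hbE := notMem_of_mem_orb ha hb
        have hbc : b ∉ insert c E' := by
          rintro (rfl | h1)
          · exact hyy' rfl
          · exact hbE h1
        obtain ⟨_, ⟨π, hπ, rfl⟩, hne⟩ :=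
          (hG.infinite_orb _ (hE'.insert c) b hbc).exists_notMem_finite (Set.finite_singleton b)
        exact hne (hG.fix_of_smul_eq hE' hbE hzb' hcon (fun e he => hπ e (Or.inr he)) (hzc' π hπ))
      exact ⟨(mem_iff b hb hz).1 hzb, hz⟩
    · rintro ⟨hza, hz⟩
      exact ⟨(mem_iff b hb hz).2 hza, (mem_iff c hc hz).2 hza⟩

end FinModel

end

section

variable {A : Type u} {G : Subgroup (Equiv.Perm A)}

theorem Flexible.of_exists (hinf : ∀ E : Set A, E.Finite → ∀ b ∉ E, (orb G E b).Infinite)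
    (h : ∀ E : Set A, E.Finite → ∀ a ∉ E, ∀ π ρ : G, (∀ e ∈ E, π.1 e = e) →
      (∀ e ∈ E, ρ.1 e = e) → π.1 a ≠ a → ρ.1 a ≠ a →
      ∃ σ : G, (∀ e ∈ insert a E, σ.1 e = e) ∧
        (σ.1 (π.1 a) = ρ.1 a ∨ σ.1 (π⁻¹.1 a) = ρ.1 a)) : Flexible G := by
  refine ⟨hinf, fun E hE a ha H hH ⟨π, hπH, hπ, hπa⟩ ρ hρ => ?_⟩
  by_cases hρa : ρ.1 a = a
  · refine hH ρ fun e he => ?_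
    rcases he with rfl | he
    · exact hρa
    · exact hρ e he
  obtain ⟨σ, hσ, hσa⟩ := h E hE a ha π ρ hπ hρ hπa hρa
  have key : ∀ τ ∈ H, (∀ e ∈ E, τ.1 e = e) → σ.1 (τ.1 a) = ρ.1 a → ρ ∈ H := by
    intro τ hτH hτ hτa
    have h1 : (σ * τ)⁻¹ * ρ ∈ H := by
      refine hH _ fun e he => ?_
      change (σ.1 * τ.1)⁻¹ (ρ.1 e) = e
      rw [Equiv.Perm.inv_eq_iff_eq]
      change ρ.1 e = σ.1 (τ.1 e)
      rcases he with rfl | he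
      · exact hτa.symm
      · rw [hρ e he, hτ e he, hσ e (Or.inr he)]
    have := H.mul_mem (H.mul_mem (hH σ hσ) hτH) h1
    rwa [mul_inv_cancel_left] at this
  rcases hσa with h1 | h1
  · exact key π hπH hπ h1
  · exact key π⁻¹ (H.inv_mem hπH) (fix_inv hπ) h1

/-- A group that preserves the classes of an equivalence relation with infinite classes and contains
all transpositions of equivalent atoms is flexible. -/
theorem Flexible.of_swap [DecidableEq A] (r : Setoid A) (hswap : ∀ a b, r a b → Equiv.swap a b ∈ G)
    (hpres : ∀ π ∈ G, ∀ a, r a (π a)) (hinf : ∀ a, {b | r a b}.Infinite) : Flexible G := by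
  have fixes : ∀ (E : Set A) (b c : A), b ∉ E → c ∉ E → ∀ e ∈ E, Equiv.swap b c e = e :=
    fun E b c hb hc e he => Equiv.swap_apply_of_ne_of_ne (fun h => hb (h ▸ he))
      (fun h => hc (h ▸ he))
  refine Flexible.of_exists (fun E hE b hb => ((hinf b).sdiff hE).mono fun c hc => ?_) ?_
  · exact ⟨⟨Equiv.swap b c, hswap b c hc.1⟩, fixes E b c hb hc.2, Equiv.swap_apply_left b c⟩
  · intro E hE a ha π ρ hπ hρ hπa hρa
    refine ⟨⟨Equiv.swap (π.1 a) (ρ.1 a),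
      hswap _ _ (r.trans (r.symm (hpres _ π.2 a)) (hpres _ ρ.2 a))⟩, fixes _ _ _ ?_ ?_,
      Or.inl (Equiv.swap_apply_left _ _)⟩
    · rintro (h | h)
      · exact hπa h
      · exact notMem_of_mem_orb ha ⟨π, hπ, rfl⟩ h
    · rintro (h | h)
      · exact hρa h
      · exact notMem_of_mem_orb ha ⟨ρ, hρ, rfl⟩ h

theorem flexible_top (A : Type u) [Infinite A] : Flexible (⊤ : Subgroup (Equiv.Perm A)) := by
  classical
  exact Flexible.of_swap ⊤ (fun _ _ _ => trivial) (fun _ _ _ => trivial) fun a =>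
    Set.infinite_univ.mono fun _ _ => trivial

theorem flexible_blockGroup {P : ℕ → Set A} (hP : (⋃ k, P k) = Set.univ)
    (hdis : Pairwise fun j k => Disjoint (P j) (P k)) (hinf : ∀ k, (P k).Infinite) :
    Flexible (blockGroup P) := by
  classical
  have hex : ∀ a, ∃ k, a ∈ P k := fun a => Set.mem_iUnion.1 (hP ▸ Set.mem_univ a)
  choose k hk using hex
  have hk' : ∀ a j, a ∈ P j ↔ k a = j := by
    refine fun a j => ⟨fun h => ?_, fun h => h ▸ hk a⟩
    by_contra hne
    exact Set.disjoint_left.1 (hdis hne) (hk a) h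
  refine Flexible.of_swap (Setoid.ker k) (fun a b hab => ?_) (fun π hπ a => ?_) fun a => ?_
  · have hab : k a = k b := hab
    have hsub : ∀ j, ∀ c ∈ P j, Equiv.swap a b c ∈ P j := by
      intro j c hc
      rw [hk'] at hc ⊢
      rcases eq_or_ne c a with rfl | hca
      · rw [Equiv.swap_apply_left, ← hab, hc]
      rcases eq_or_ne c b with rfl | hcb
      · rw [Equiv.swap_apply_right, hab, hc]
      · rw [Equiv.swap_apply_of_ne_of_ne hca hcb, hc]
    refine fun j => Set.Subset.antisymm (by rintro _ ⟨c, hc, rfl⟩; exact hsub j c hc) fun c hc =>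
      ⟨_, hsub j c hc, Equiv.swap_apply_self a b c⟩
  · have : π a ∈ P (k a) := hπ (k a) ▸ Set.mem_image_of_mem π (hk a)
    exact ((hk' _ _).1 this).symm
  · refine (hinf (k a)).mono fun b hb => ?_
    exact ((hk' b _).1 hb).symm

namespace FinModel

theorem exists_atoms (G : Subgroup (Equiv.Perm A)) :
    ∃ x : FinModel G, IsSetOf x (Set.range (ofAtom G)) :=
  exists_isSetOf _ Set.finite_empty (by
    rintro π - _ ⟨a, rfl⟩
    exact ⟨_, rfl⟩)

theorem exists_ofAtom_mem_notMem {x y : FinModel G} (hx : IsSetOf x (Set.range (ofAtom G)))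
    (hy : IsSubset y x) (hinf : IsInf y) {E : Set A} (hE : E.Finite) :
    ∃ a, ofAtom G a ϵ y ∧ a ∉ E := by
  obtain ⟨t, ht, htE⟩ := (isInf_iff.1 hinf).2.exists_notMem_finite (hE.image (ofAtom G))
  obtain ⟨a, rfl⟩ := (hx.2 t).1 (hy.2 t ht)
  exact ⟨a, ht, fun ha => htE ⟨a, ha, rfl⟩⟩

theorem isInf_of_forall_mem {y : FinModel G} (hy : IsSet y) {S : Set A} (hS : S.Infinite)
    (h : ∀ a ∈ S, ofAtom G a ϵ y) : IsInf y :=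
  isInf_iff.2 ⟨hy, (hS.image ofAtom_injective.injOn).mono (by rintro _ ⟨a, ha, rfl⟩; exact h a ha)⟩

/-- In the basic Fraenkel model the set of atoms is amorphous. -/
theorem exists_isAmorphous [Infinite A] :
    ∃ x : FinModel (⊤ : Subgroup (Equiv.Perm A)), IsAmorphous x := by
  classical
  obtain ⟨x, hx⟩ := exists_atoms (⊤ : Subgroup (Equiv.Perm A))
  refine ⟨x, isInf_of_forall_mem hx.1 Set.infinite_univ fun a _ => (hx.2 _).2 ⟨a, rfl⟩, ?_⟩
  rintro ⟨y, z, hy, hz, hyi, hzi, hdis, -⟩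
  obtain ⟨E, hE, hsupp⟩ := exists_supp y
  obtain ⟨b, hb, hbE⟩ := exists_ofAtom_mem_notMem hx hy hyi hE
  obtain ⟨c, hc, hcE⟩ := exists_ofAtom_mem_notMem hx hz hzi hE
  refine hdis _ ⟨?_, hc⟩
  have := hsupp.inv_elts ⟨Equiv.swap b c, trivial⟩ (fun e he =>
    Equiv.swap_apply_of_ne_of_ne (fun h => hbE (h ▸ he)) (fun h => hcE (h ▸ he))) _ hb
  rw [smul_ofAtom] at this
  change ofAtom _ (Equiv.swap b c b) ϵ y at this
  rwa [Equiv.swap_apply_left] at this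

theorem not_isWellOrderOn_atoms [Infinite A] (hG : Flexible G) {x r : FinModel G}
    (hx : IsSetOf x (Set.range (ofAtom G))) : ¬ IsWellOrderOn r x := by
  rintro ⟨-, hirr, htrans, -, hmin⟩
  obtain ⟨E, hE, hsupp⟩ := exists_supp r
  obtain ⟨y, hy⟩ := exists_isSetOf (ofAtom G '' Eᶜ) hE (by
    rintro π hπ _ ⟨a, ha, rfl⟩
    exact ⟨_, notMem_of_mem_orb ha ⟨π, hπ, rfl⟩, rfl⟩)
  obtain ⟨b, hb⟩ := hE.infinite_compl.nonempty
  have hatom : ∀ a, ofAtom G a ϵ x := fun a => (hx.2 _).2 ⟨a, rfl⟩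
  obtain ⟨_, ha, hleast⟩ := hmin y ⟨hy.1, fun z hz => by
    obtain ⟨a, -, rfl⟩ := (hy.2 z).1 hz
    exact hatom a⟩ ⟨_, (hy.2 _).2 ⟨b, hb, rfl⟩⟩
  obtain ⟨a, haE, rfl⟩ := (hy.2 _).1 ha
  obtain ⟨_, ⟨π, hπ, rfl⟩, hne⟩ :=
    (hG.infinite_orb E hE a haE).exists_notMem_finite (Set.finite_singleton a)
  have rel_of : ∀ ρ : G, (∀ e ∈ E, ρ.1 e = e) → ρ.1 a ≠ a → Rel r (ofAtom G a) (ofAtom G (ρ.1 a)) :=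
    fun ρ hρ hρa => (hleast _ ((hy.2 _).2 ⟨_, notMem_of_mem_orb haE ⟨ρ, hρ, rfl⟩, rfl⟩)).resolve_left
      fun h => hρa (ofAtom_injective h)
  have h1 := rel_of π hπ hne
  have h2 := hsupp.rel hπ (rel_of π⁻¹ (fix_inv hπ) fun h => hne (by
    change (π.1)⁻¹ a = a at h
    rw [Equiv.Perm.inv_eq_iff_eq] at h
    exact h.symm))
  rw [smul_ofAtom, smul_ofAtom] at h2
  have h3 : π.1 (π⁻¹.1 a) = a := π.1.apply_symm_apply a
  rw [h3] at h2
  exact hirr _ (hatom a) (htrans _ _ _ (hatom _) (hatom _) (hatom _) h1 h2)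

end FinModel

end

/-! ### Mostowski's model -/

section

variable {A : Type u} [LinearOrder A]

theorem smul_lt_smul_iff (π : orderAutGroup A) {a b : A} : π.1 a < π.1 b ↔ a < b := π.2 a b

theorem smul_le_smul_iff (π : orderAutGroup A) {a b : A} : π.1 a ≤ π.1 b ↔ a ≤ b := by
  rw [← not_lt, ← not_lt, smul_lt_smul_iff]

theorem exists_gt_of_finite [NoMaxOrder A] [Nonempty A] {E : Set A} (hE : E.Finite) : ∃ a, ∀ e ∈ E, e < a := by
  obtain ⟨b, hb⟩ := hE.bddAbove
  obtain ⟨a, ha⟩ := exists_gt b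
  exact ⟨a, fun e he => (hb he).trans_lt ha⟩

variable [Countable A] [DenselyOrdered A] [NoMinOrder A] [NoMaxOrder A] [Nonempty A]

theorem mem_orb_iff {E : Set A} (hE : E.Finite) {a c : A} :
    c ∈ orb (orderAutGroup A) E a ↔ ∀ e ∈ E, (e < a ↔ e < c) ∧ (a < e ↔ c < e) := by
  constructor
  · rintro ⟨π, hπ, rfl⟩ e he
    have h1 := smul_lt_smul_iff π (a := e) (b := a)
    have h2 := smul_lt_smul_iff π (a := a) (b := e)
    rw [hπ e he] at h1 h2
    exact ⟨h1.symm, h2.symm⟩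
  · intro h
    classical
    let f : Finset (A × A) := insert (a, c) (hE.toFinset.image fun e => (e, e))
    have hf : ∀ p ∈ f, p = (a, c) ∨ ∃ e ∈ E, p = (e, e) := by
      intro p hp
      rcases Finset.mem_insert.1 hp with h1 | h1
      · exact Or.inl h1
      · obtain ⟨e, he, rfl⟩ := Finset.mem_image.1 h1
        exact Or.inr ⟨e, hE.mem_toFinset.1 he, rfl⟩
    obtain ⟨i, hi⟩ := exists_orderIso_extending (α := A) (β := A) ⟨f, by
      intro p hp q hq
      rcases hf p hp with rfl | ⟨e, he, rfl⟩ <;> rcases hf q hq with rfl | ⟨e', he', rfl⟩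
      · simp
      · simp [cmp, cmpUsing, h e' he']
      · simp [cmp, cmpUsing, h e he]
      · rfl⟩
    refine ⟨⟨i.toEquiv, fun x y => i.lt_iff_lt⟩, fun e he => ?_, ?_⟩
    · exact hi (e, e) (Finset.mem_insert_of_mem
        (Finset.mem_image_of_mem _ (hE.mem_toFinset.2 he)))
    · exact hi (a, c) (Finset.mem_insert_self _ _)

theorem infinite_orb_inter_Ioi {E : Set A} (hE : E.Finite) {b : A} (hb : b ∉ E) :
    (orb (orderAutGroup A) E b ∩ Set.Ioi b).Infinite := by
  classical
  obtain ⟨q, hq1, hq2⟩ := Order.exists_between_finsets {b} {e ∈ hE.toFinset | b < e} (by simp)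
  have hbq : b < q := hq1 b (Finset.mem_singleton_self b)
  refine (Set.Ioo_infinite hbq).mono fun c hc => ⟨(mem_orb_iff hE).2 fun e he => ?_, hc.1⟩
  rcases lt_trichotomy e b with h | rfl | h
  · have := h.trans hc.1
    simp [h, this, h.not_gt, this.not_gt]
  · exact absurd he hb
  · have := hc.2.trans (hq2 e (by simp [he, h]))
    simp [h, this, h.not_gt, this.not_gt]

theorem infinite_orb_inter_Iio {E : Set A} (hE : E.Finite) {b : A} (hb : b ∉ E) :
    (orb (orderAutGroup A) E b ∩ Set.Iio b).Infinite := by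
  classical
  obtain ⟨q, hq1, hq2⟩ := Order.exists_between_finsets {e ∈ hE.toFinset | e < b} {b} (by simp)
  have hbq : q < b := hq2 b (Finset.mem_singleton_self b)
  refine (Set.Ioo_infinite hbq).mono fun c hc => ⟨(mem_orb_iff hE).2 fun e he => ?_, hc.2⟩
  rcases lt_trichotomy e b with h | rfl | h
  · have := (hq1 e (by simp [he, h])).trans hc.1
    simp [h, this, h.not_gt, this.not_gt]
  · exact absurd he hb
  · have := hc.2.trans h
    simp [h, this, h.not_gt, this.not_gt]

theorem flexible_orderAutGroup : Flexible (orderAutGroup A) := by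
  refine Flexible.of_exists
    (fun E hE b hb => (infinite_orb_inter_Ioi hE hb).mono Set.inter_subset_left) ?_
  intro E hE a ha π ρ hπ hρ hπa hρa
  have key : ∀ τ : orderAutGroup A, (∀ e ∈ E, τ.1 e = e) →
      (a < τ.1 a ↔ a < ρ.1 a) → (τ.1 a < a ↔ ρ.1 a < a) →
      ∃ σ : orderAutGroup A, (∀ e ∈ insert a E, σ.1 e = e) ∧ σ.1 (τ.1 a) = ρ.1 a := by
    intro τ hτ h1 h2
    refine (mem_orb_iff (hE.insert a)).2 fun e he => ?_
    rcases he with rfl | he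
    · exact ⟨h1, h2⟩
    · have h3 := (mem_orb_iff hE (a := a)).1 ⟨τ, hτ, rfl⟩ e he
      have h4 := (mem_orb_iff hE (a := a)).1 ⟨ρ, hρ, rfl⟩ e he
      exact ⟨h3.1.symm.trans h4.1, h3.2.symm.trans h4.2⟩
  have hinv1 := smul_lt_smul_iff π (a := a) (b := π⁻¹.1 a)
  have hinv2 := smul_lt_smul_iff π (a := π⁻¹.1 a) (b := a)
  have h3 : π.1 (π⁻¹.1 a) = a := π.1.apply_symm_apply a
  rw [h3] at hinv1 hinv2
  by_cases hc : a < π.1 a ↔ a < ρ.1 a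
  · obtain ⟨σ, hσ, h⟩ := key π hπ hc (by grind)
    exact ⟨σ, hσ, Or.inl h⟩
  · obtain ⟨σ, hσ, h⟩ := key π⁻¹ (fix_inv hπ) (by grind) (by grind)
    exact ⟨σ, hσ, Or.inr h⟩

namespace FinModel

theorem not_isAmorphous_subset_atoms {x y : FinModel (orderAutGroup A)}
    (hx : IsSetOf x (Set.range (ofAtom (orderAutGroup A)))) (hy : IsSubset y x) :
    ¬ IsAmorphous y := by
  rintro ⟨hinf, hno⟩
  obtain ⟨E, hE, hsupp⟩ := exists_supp y
  obtain ⟨a, hay, ha⟩ := exists_ofAtom_mem_notMem hx hy hinf hE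
  have horb : ∀ c ∈ orb (orderAutGroup A) E a, ofAtom _ c ϵ y := by
    rintro _ ⟨π, hπ, rfl⟩
    exact hsupp.inv_elts π hπ _ hay
  have part : ∀ p : A → Prop, (∀ π : orderAutGroup A, π.1 a = a → ∀ b, p b → p (π.1 b)) →
      ∃ z : FinModel (orderAutGroup A), IsSetOf z {t | ∃ b, t = ofAtom _ b ∧ t ϵ y ∧ p b} := by
    intro p hp
    have : Small.{u} {t | ∃ b, t = ofAtom (orderAutGroup A) b ∧ t ϵ y ∧ p b} :=
      small_subset (s := elts y) fun t ⟨_, _, h, _⟩ => h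
    refine exists_isSetOf _ (hE.insert a) ?_
    rintro π hπ _ ⟨b, rfl, hby, hb⟩
    exact ⟨_, rfl, hsupp.inv_elts π (fun e he => hπ e (Or.inr he)) _ hby,
      hp π (hπ a (Or.inl rfl)) b hb⟩
  obtain ⟨z₁, hz₁⟩ := part (fun b => b ≤ a) fun π hπ b hb => by
    have := (smul_le_smul_iff π).2 hb
    rwa [hπ] at this
  obtain ⟨z₂, hz₂⟩ := part (fun b => a < b) fun π hπ b hb => by
    have := (smul_lt_smul_iff π).2 hb
    rwa [hπ] at this
  refine hno ⟨z₁, z₂, ⟨hz₁.1, fun t ht => ?_⟩, ⟨hz₂.1, fun t ht => ?_⟩,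
    isInf_of_forall_mem hz₁.1 (infinite_orb_inter_Iio hE ha) fun b hb =>
      (hz₁.2 _).2 ⟨b, rfl, horb b hb.1, le_of_lt hb.2⟩,
    isInf_of_forall_mem hz₂.1 (infinite_orb_inter_Ioi hE ha) fun b hb =>
      (hz₂.2 _).2 ⟨b, rfl, horb b hb.1, hb.2⟩, fun t ⟨h1, h2⟩ => ?_, fun t ht => ?_⟩
  · obtain ⟨_, _, h, _⟩ := (hz₁.2 t).1 ht
    exact h
  · obtain ⟨_, _, h, _⟩ := (hz₂.2 t).1 ht
    exact h
  · obtain ⟨b, rfl, -, hb⟩ := (hz₁.2 t).1 h1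
    obtain ⟨c, hbc, -, hc⟩ := (hz₂.2 _).1 h2
    obtain rfl := ofAtom_injective hbc
    exact absurd hc hb.not_gt
  · obtain ⟨b, rfl⟩ := (hx.2 t).1 (hy.2 t ht)
    rcases le_or_gt b a with h | h
    · exact Or.inl ((hz₁.2 _).2 ⟨b, rfl, ht, h⟩)
    · exact Or.inr ((hz₂.2 _).2 ⟨b, rfl, ht, h⟩)

theorem not_woam : ¬ WOAM (FinModel (orderAutGroup A)) := by
  intro h
  obtain ⟨x, hx⟩ := exists_atoms (orderAutGroup A)
  have : Infinite A := NoMaxOrder.infinite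
  rcases h x hx.1 with ⟨r, hr⟩ | ⟨y, hy, hya⟩
  · exact not_isWellOrderOn_atoms flexible_orderAutGroup hx hr
  · exact not_isAmorphous_subset_atoms hx hy hya

theorem not_cs : ¬ CS (FinModel (orderAutGroup A)) := by
  intro h
  obtain ⟨x, hx⟩ := exists_atoms (orderAutGroup A)
  have hatom : ∀ a, ofAtom (orderAutGroup A) a ϵ x := fun a => (hx.2 _).2 ⟨a, rfl⟩
  obtain ⟨r, hr, hR⟩ := exists_rel (G := orderAutGroup A)
    (fun s t => ∃ a b, s = ofAtom _ a ∧ t = ofAtom _ b ∧ a ≤ b) (Set.range (ofAtom _))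
    (Set.range (ofAtom _)) (by rintro _ _ ⟨a, b, rfl, rfl, -⟩; exact ⟨⟨a, rfl⟩, ⟨b, rfl⟩⟩)
    Set.finite_empty (by
      rintro π - _ _ ⟨a, b, rfl, rfl, hab⟩
      exact ⟨_, _, rfl, rfl, (smul_le_smul_iff π).2 hab⟩)
  have hR' : ∀ a b, Rel r (ofAtom (orderAutGroup A) a) (ofAtom _ b) ↔ a ≤ b := by
    intro a b
    rw [hR]
    constructor
    · rintro ⟨a', b', h1, h2, hab⟩
      rwa [ofAtom_injective h1, ofAtom_injective h2]
    · exact fun hab => ⟨a, b, rfl, rfl, hab⟩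
  have forall_iff : ∀ {t : FinModel (orderAutGroup A)}, t ϵ x → ∃ a, t = ofAtom _ a := by
    intro t ht
    obtain ⟨a, rfl⟩ := (hx.2 t).1 ht
    exact ⟨a, rfl⟩
  obtain ⟨D, D', hD, hD', hdis⟩ := h x r ⟨hx.1, hr.1, fun s hs => by
      obtain ⟨a, rfl⟩ := forall_iff hs
      exact (hR' a a).2 le_rfl, fun s t hs ht hst hts => by
      obtain ⟨a, rfl⟩ := forall_iff hs
      obtain ⟨b, rfl⟩ := forall_iff ht
      rw [((hR' a b).1 hst).antisymm ((hR' b a).1 hts)], fun s t v hs ht hv hst htv => by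
      obtain ⟨a, rfl⟩ := forall_iff hs
      obtain ⟨b, rfl⟩ := forall_iff ht
      obtain ⟨c, rfl⟩ := forall_iff hv
      exact (hR' a c).2 (((hR' a b).1 hst).trans ((hR' b c).1 htv))⟩ (by
    rintro ⟨t, ht, hmax⟩
    obtain ⟨a, rfl⟩ := forall_iff ht
    obtain ⟨b, hab⟩ := exists_gt a
    exact hab.ne' (ofAtom_injective (hmax _ (hatom b) ((hR' a b).2 hab.le))))
  obtain ⟨E, hE, hsupp⟩ := exists_supp D
  obtain ⟨a, ha⟩ := exists_gt_of_finite hE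
  have key : ∀ D, IsCofinalIn r x D → ∃ c, ofAtom _ c ϵ D ∧ ∀ e ∈ E, e < c := by
    intro D hD
    obtain ⟨t, ht, hat⟩ := hD.2 _ (hatom a)
    obtain ⟨c, rfl⟩ := forall_iff (hD.1.2 t ht)
    exact ⟨c, ht, fun e he => (ha e he).trans_le ((hR' a c).1 hat)⟩
  obtain ⟨c, hc, hcE⟩ := key D hD
  obtain ⟨d, hd, hdE⟩ := key D' hD'
  obtain ⟨π, hπ, rfl⟩ : d ∈ orb (orderAutGroup A) E c := (mem_orb_iff hE).2 fun e he => by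
    simp [hcE e he, hdE e he, (hcE e he).not_gt, (hdE e he).not_gt]
  exact hdis _ ⟨hsupp.inv_elts π hπ _ hc, hd⟩

theorem not_antichainPrinciple : ¬ AntichainPrinciple (FinModel (orderAutGroup A)) := by
  intro h
  let q : A → A → FinModel (orderAutGroup A) := fun a c => opair (ofAtom _ a) (ofAtom _ c)
  have hq : ∀ {a b c d}, q a b = q c d → a = c ∧ b = d := fun h =>
    (opair_inj.1 h).imp (fun h => ofAtom_injective h) (fun h => ofAtom_injective h)
  have smul_q : ∀ (π : orderAutGroup A) a c, π • q a c = q (π.1 a) (π.1 c) := fun π a c =>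
    smul_opair π _ _
  let K : Set (FinModel (orderAutGroup A)) := {p | ∃ a c, a < c ∧ p = q a c}
  have : Small.{u} K := small_subset (s := Set.range fun ac : A × A => q ac.1 ac.2) (by
    rintro _ ⟨a, c, -, rfl⟩
    exact ⟨(a, c), rfl⟩)
  obtain ⟨P, hP⟩ := exists_isSetOf K Set.finite_empty (by
    rintro π - _ ⟨a, c, hac, rfl⟩
    exact ⟨_, _, (smul_lt_smul_iff π).2 hac, smul_q π a c⟩)
  obtain ⟨r, hr, hR⟩ := exists_rel (G := orderAutGroup A)
    (fun s t => ∃ a c d, a < c ∧ a < d ∧ c ≤ d ∧ s = q a c ∧ t = q a d) K K (by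
      rintro _ _ ⟨a, c, d, hac, had, -, rfl, rfl⟩
      exact ⟨⟨a, c, hac, rfl⟩, ⟨a, d, had, rfl⟩⟩) Set.finite_empty (by
      rintro π - _ _ ⟨a, c, d, hac, had, hcd, rfl, rfl⟩
      exact ⟨_, _, _, (smul_lt_smul_iff π).2 hac, (smul_lt_smul_iff π).2 had,
        (smul_le_smul_iff π).2 hcd, smul_q π a c, smul_q π a d⟩)
  obtain ⟨Y, hY, hmax⟩ := h P r ⟨hP.1, hr.1, fun s hs => by
      obtain ⟨a, c, hac, rfl⟩ := (hP.2 s).1 hs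
      exact (hR _ _).2 ⟨a, c, c, hac, hac, le_rfl, rfl, rfl⟩, fun s t _ _ hst hts => by
      obtain ⟨a, c, d, -, -, hcd, rfl, rfl⟩ := (hR _ _).1 hst
      obtain ⟨a', c', d', -, -, hcd', h1, h2⟩ := (hR _ _).1 hts
      rw [hcd.antisymm (by rwa [(hq h1).2, (hq h2).2])], fun s t v _ _ _ hst htv => by
      obtain ⟨a, c, d, hac, -, hcd, rfl, rfl⟩ := (hR _ _).1 hst
      obtain ⟨a', c', d', -, had', hcd', h1, rfl⟩ := (hR _ _).1 htv
      obtain ⟨rfl, rfl⟩ := hq h1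
      exact (hR _ _).2 ⟨a, c, d', hac, had', hcd.trans hcd', rfl, rfl⟩⟩
  obtain ⟨E, hE, hsupp⟩ := exists_supp Y
  obtain ⟨a, ha⟩ := exists_gt_of_finite hE
  obtain ⟨c, hac⟩ := exists_gt a
  have hex : ∃ c, a < c ∧ q a c ϵ Y := by
    by_contra! hcon
    obtain ⟨S, hS, hsS⟩ := exists_supp_of_finite (Set.toFinite {Y, q a c})
    obtain ⟨Z, hZ⟩ := exists_isSetOf (insert (q a c) (elts Y)) hS (by
      rintro π hπ z (rfl | hz)
      · exact Or.inl (hsS _ (Set.mem_insert_of_mem _ rfl) π hπ)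
      · exact Or.inr ((hsS Y (Set.mem_insert _ _)).inv_elts π hπ z hz))
    have hZY : Z = Y := hmax Z ⟨⟨hZ.1, fun z hz => by
        rcases (hZ.2 z).1 hz with rfl | hz
        · exact (hP.2 _).2 ⟨a, c, hac, rfl⟩
        · exact hY.1.2 z hz⟩, fun s t hs ht hst => by
        obtain ⟨a', d, d', hd, hd', -, rfl, rfl⟩ := (hR _ _).1 hst
        rcases (hZ.2 _).1 hs with h1 | h1 <;> rcases (hZ.2 _).1 ht with h2 | h2
        · rw [h1, h2]
        · obtain ⟨rfl, rfl⟩ := hq h1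
          exact absurd h2 (hcon _ hd')
        · obtain ⟨rfl, rfl⟩ := hq h2
          exact absurd h1 (hcon _ hd)
        · exact hY.2 _ _ h1 h2 hst⟩ ⟨hY.1.1, fun z hz => (hZ.2 z).2 (Or.inr hz)⟩
    exact hcon c hac (hZY ▸ (hZ.2 _).2 (Or.inl rfl))
  obtain ⟨d, had, hdY⟩ := hex
  have hdE : d ∉ insert a E := by
    rintro (h1 | h1)
    · exact had.ne' h1
    · exact lt_asymm had (ha d h1)
  obtain ⟨_, ⟨π, hπ, rfl⟩, hlt⟩ := (infinite_orb_inter_Ioi (hE.insert a) hdE).nonempty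
  have hdY' := hsupp.inv_elts π (fun e he => hπ e (Or.inr he)) _ hdY
  rw [smul_q, hπ a (Or.inl rfl)] at hdY'
  have hlt : d < π.1 d := hlt
  exact hlt.ne (hq (hY.2 _ _ hdY hdY' ((hR _ _).2
    ⟨a, d, _, had, had.trans hlt, hlt.le, rfl, rfl⟩))).2

end FinModel

end

end FM

theorem theorem4p1 (m n : ℕ) (hm : 2 ≤ m) (hn : 2 ≤ n) :
    ((∀ (A : Type u) [Countable A] [Infinite A],
        FM.IsZFA (FM.N1 A) ∧ FM.RRT m n (FM.N1 A) ∧ ¬ FM.NoAmorphous (FM.N1 A)) ∧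
      ¬ FM.ImpliesInZFA.{u + 1} (fun V _ => FM.RRT m n V) (fun V _ => FM.NoAmorphous V)) ∧
    ((∀ (A : Type u) [LinearOrder A], Nonempty (A ≃o ℚ) →
        FM.IsZFA (FM.N3 A) ∧ FM.RRT m n (FM.N3 A) ∧ ¬ FM.WOAM (FM.N3 A) ∧ ¬ FM.CS (FM.N3 A) ∧
          ¬ FM.AntichainPrinciple (FM.N3 A)) ∧
      ¬ FM.ImpliesInZFA.{u + 1} (fun V _ => FM.RRT m n V) (fun V _ => FM.WOAM V) ∧
      ¬ FM.ImpliesInZFA.{u + 1} (fun V _ => FM.RRT m n V) (fun V _ => FM.CS V) ∧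
      ¬ FM.ImpliesInZFA.{u + 1} (fun V _ => FM.RRT m n V) (fun V _ => FM.AntichainPrinciple V)) ∧
    ∀ (A : Type u) [Countable A] (P : ℕ → Set A), (⋃ k, P k) = Set.univ →
      Pairwise (fun j k => Disjoint (P j) (P k)) → (∀ k, (P k).Infinite) →
        FM.IsZFA (FM.N26 P) ∧ FM.RRT m n (FM.N26 P) ∧ FM.DeltaSL (FM.N26 P) := by
  have h1 : ∀ (A : Type u) [Countable A] [Infinite A],
      FM.IsZFA (FM.N1 A) ∧ FM.RRT m n (FM.N1 A) ∧ ¬ FM.NoAmorphous (FM.N1 A) := fun A _ _ =>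
    ⟨FM.FinModel.isZFA _, FM.FinModel.rrt (FM.flexible_top A) m n,
      fun h => h FM.FinModel.exists_isAmorphous⟩
  have h3 : ∀ (A : Type u) [LinearOrder A], Nonempty (A ≃o ℚ) →
      FM.IsZFA (FM.N3 A) ∧ FM.RRT m n (FM.N3 A) ∧ ¬ FM.WOAM (FM.N3 A) ∧ ¬ FM.CS (FM.N3 A) ∧
        ¬ FM.AntichainPrinciple (FM.N3 A) := by
    rintro A _ ⟨e⟩
    have : Countable A := e.toEquiv.countable_iff.2 inferInstance
    have : DenselyOrdered A := (denselyOrdered_iff_of_orderIsoClass e).2 inferInstance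
    have : NoMinOrder A := ⟨fun a => ⟨e.symm (e a - 1), by rw [e.symm_apply_lt]; simp⟩⟩
    have : NoMaxOrder A := ⟨fun a => ⟨e.symm (e a + 1), by rw [e.lt_symm_apply]; simp⟩⟩
    have : Nonempty A := ⟨e.symm 0⟩
    exact ⟨FM.FinModel.isZFA _, FM.FinModel.rrt FM.flexible_orderAutGroup m n,
      FM.FinModel.not_woam, FM.FinModel.not_cs, FM.FinModel.not_antichainPrinciple⟩
  have hQ := h3 (ULift.{u} ℚ) ⟨OrderIso.ofRelIsoLT ⟨Equiv.ulift, Iff.rfl⟩⟩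
  refine ⟨⟨h1, fun h => ?_⟩, ⟨h3, fun h => ?_, fun h => ?_, fun h => ?_⟩, fun A _ P hP hdis hinf => ?_⟩
  · obtain ⟨hZ, hR, hN⟩ := h1 (ULift.{u} ℕ)
    exact hN (h _ hZ hR)
  · exact hQ.2.2.1 (h _ hQ.1 hQ.2.1)
  · exact hQ.2.2.2.1 (h _ hQ.1 hQ.2.1)
  · exact hQ.2.2.2.2 (h _ hQ.1 hQ.2.1)
  · have hG := FM.flexible_blockGroup hP hdis hinf
    exact ⟨FM.FinModel.isZFA _, FM.FinModel.rrt hG m n, FM.FinModel.deltaSL hG⟩
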